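/- Let $\mathfrak g$ be the finite-dimensional simple Lie algebra over $\mathbb C$ of type $G_2$, with Chevalley generators $E_{10},H_{10},F_{10}$ (for the short simple root $\alpha$) and $E_{01},H_{01},F_{01}$ (for the long simple root $\beta$), so that $\beta(H_{10})=-3$ and $\alpha(H_{01})=-1$; let $\mathfrak h=\mathbb C H_{10}\oplus\mathbb C H_{01}$ and let $\mathfrak n_+$ be the subalgebra generated by $E_{10},E_{01}$. Put $$E_{11}=[E_{10},E_{01}],\quad E_{21}=\tfrac12[E_{11},E_{10}],\quad E_{31}=\tfrac13[E_{21},E_{10}],\quad E_{32}=[E_{31},E_{01}],$$ $$F_{11}=[F_{01},F_{10}],\quad F_{21}=\tfrac12[F_{10},F_{11}],\quad F_{31}=\tfrac13[F_{10},F_{21}],\quad F_{32}=[F_{01},F_{31}].$$ Let $(\cdot,\cdot)$ be the Killing form, normalized by $(\theta,\theta)=2$ for the highest root $\theta=3\alpha+2\beta$ (equivalently, $(\theta^\vee,\theta^\vee)=2$ for its coroot $\theta^\vee=[E_{32},F_{32}]$), and let $\hat{\mathfrak g}=\mathfrak g\otimes\mathbb C[t,t^{-1}]\oplus\mathbb C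 K$ be the affine Lie algebra, with $K$ central and, for $x(n)=x\otimes t^n$, $$[x(m),y(n)]=[x,y](m+n)+m\,(x,y)\,\delta_{m+n,0}K .$$ For $k\in\mathbb C$ let $N(k,0)=\mathcal U(\hat{\mathfrak g})\otimes_{\mathcal U(\mathfrak g\oplus\mathbb C K\oplus\mathfrak g\otimes t\mathbb C[t])}\mathbb C$, where $\mathfrak g$ and $\mathfrak g\otimes t\mathbb C[t]$ act on $\mathbb C$ by $0$ and $K$ acts by $k$, and let $\mathbf 1=1\otimes1$. Put $\hat{\mathfrak h}=\mathfrak h\oplus\mathbb C K$ and $\hat{\mathfrak n}_+=\mathfrak n_+\oplus\mathfrak g\otimes t\mathbb C[t]$. A vector $v\in N(k,0)$ is called singular if it is a weight vector (a nonzero simultaneous eigenvector of $\hat{\mathfrak h}$) and $\hat{\mathfrak n}_+v=0$. In $\mathcal U(\hat{\mathfrak g})$ put $$\begin{aligned} a&=E_{21}(-1),\\ b&=E_{31}(-1)E_{11}(-1)-E_{32}(-1)E_{10}(-1),\\ c&=E_{31}(-1)^2E_{01}(-1)-E_{32}(-1)E_{31}(-1)H_{01}(-1)-E_{32}(-1)^2F_{01}(-1),\\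 w&=E_{31}(-1)E_{32}(-2)-E_{32}(-1)E_{31}(-2),\\ u&=\tfrac13a^2-b,\qquad v=\tfrac29a^3-ab-3c. \end{aligned}$$ **Proposition 2.3.** The following vectors are singular (in particular, nonzero and annihilated by $E_{10}(0)$, $E_{01}(0)$ and $F_{32}(1)$): - $u\,\mathbf 1\in N(k,0)$ for $k=-\tfrac53$; - $(v+w)\,\mathbf 1\in N(k,0)$ for $k=-\tfrac43$; - $u(v-w)\,\mathbf 1\in N(k,0)$ for $k=-\tfrac23$. -/

import Mathlib

open scoped TensorProduct

noncomputable section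

namespace AffineG2

/-! ### Affine Lie algebras -/

/-- The invariant form `(·,·)` on a simple Lie algebra `𝔤` over `ℂ`: the multiple of the Killing
form for which `(t, t) = 2`.  It is used with `t = θ^∨`, the coroot of the highest root `θ`.
Since `(θ^∨, θ^∨) = 4 / (θ, θ)`, this is the Killing form normalized by `(θ, θ) = 2`. -/
def normalizedKillingForm (𝔤 : Type*) [LieRing 𝔤] [LieAlgebra ℂ 𝔤] (t : 𝔤) :
    LinearMap.BilinForm ℂ 𝔤 :=
  (2 / killingForm ℂ 𝔤 t t) • killingForm ℂ 𝔤

theorem normalizedKillingForm_apply {𝔤 : Type*} [LieRing 𝔤] [LieAlgebra ℂ 𝔤] (t x y : 𝔤) :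
    normalizedKillingForm 𝔤 t x y = 2 / killingForm ℂ 𝔤 t t * killingForm ℂ 𝔤 x y := rfl

theorem normalizedKillingForm_lieInvariant (𝔤 : Type*) [LieRing 𝔤] [LieAlgebra ℂ 𝔤] (t : 𝔤) :
    (normalizedKillingForm 𝔤 t).lieInvariant 𝔤 := by
  intro x y z
  have h := LieModule.traceForm_lieInvariant ℂ 𝔤 𝔤 x y z
  simp only [normalizedKillingForm_apply, killingForm] at h ⊢
  rw [h, mul_neg]

theorem normalizedKillingForm_isSymm (𝔤 : Type*) [LieRing 𝔤] [LieAlgebra ℂ 𝔤] (t : 𝔤) :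
    (normalizedKillingForm 𝔤 t).IsSymm :=
  ⟨fun x y => by
    simp only [normalizedKillingForm_apply, killingForm]
    exact congrArg _ (LieModule.traceForm_comm ℂ 𝔤 𝔤 x y)⟩

/-- The cocycle `(x ⊗ tᵐ, y ⊗ tⁿ) ↦ m (x, y) δ_{m+n,0}` on the loop algebra.  (The cocycle of
Mathlib is `n (x, y) δ_{m+n,0}`, whence the sign.) -/
def affineCocycle (𝔤 : Type*) [LieRing 𝔤] [LieAlgebra ℂ 𝔤] (t : 𝔤) :
    LieModule.Cohomology.twoCocycle ℂ (LieAlgebra.loopAlgebra ℂ ℤ 𝔤)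
      (TrivialLieModule ℂ (LieAlgebra.loopAlgebra ℂ ℤ 𝔤) ℂ) :=
  (-1 : ℂ) • LieAlgebra.LoopAlgebra.twoCocycleOfBilinear ℂ ℤ 𝔤 (normalizedKillingForm 𝔤 t)
    (normalizedKillingForm_lieInvariant 𝔤 t) (normalizedKillingForm_isSymm 𝔤 t)

/-- The affine Lie algebra `𝔤 ⊗ ℂ[t, t⁻¹] ⊕ ℂ K`. -/
def AffineLieAlgebra (𝔤 : Type*) [LieRing 𝔤] [LieAlgebra ℂ 𝔤] (t : 𝔤) : Type _ :=
  LieAlgebra.ofTwoCocycle (affineCocycle 𝔤 t)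

instance (𝔤 : Type*) [LieRing 𝔤] [LieAlgebra ℂ 𝔤] (t : 𝔤) : LieRing (AffineLieAlgebra 𝔤 t) :=
  inferInstanceAs (LieRing (LieAlgebra.ofTwoCocycle (affineCocycle 𝔤 t)))

instance (𝔤 : Type*) [LieRing 𝔤] [LieAlgebra ℂ 𝔤] (t : 𝔤) :
    LieAlgebra ℂ (AffineLieAlgebra 𝔤 t) :=
  inferInstanceAs (LieAlgebra ℂ (LieAlgebra.ofTwoCocycle (affineCocycle 𝔤 t)))

/-- The element `x(n) = x ⊗ tⁿ` of the affine Lie algebra. -/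
def mode {𝔤 : Type*} [LieRing 𝔤] [LieAlgebra ℂ 𝔤] {t : 𝔤} (x : 𝔤) (n : ℤ) :
    AffineLieAlgebra 𝔤 t :=
  LieAlgebra.ofProd (affineCocycle 𝔤 t) (AddMonoidAlgebra.single n 1 ⊗ₜ[ℂ] x, 0)

/-- The central element `K` of the affine Lie algebra. -/
def central (𝔤 : Type*) [LieRing 𝔤] [LieAlgebra ℂ 𝔤] (t : 𝔤) : AffineLieAlgebra 𝔤 t :=
  LieAlgebra.ofProd (affineCocycle 𝔤 t) (0, (TrivialLieModule.equiv ℂ _ ℂ).symm 1)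

/-- Check of the sign: the defining relation of the affine Lie algebra. -/
theorem lie_mode_mode {𝔤 : Type*} [LieRing 𝔤] [LieAlgebra ℂ 𝔤] {t : 𝔤} (x y : 𝔤) (m n : ℤ) :
    ⁅(mode x m : AffineLieAlgebra 𝔤 t), mode y n⁆ = mode ⁅x, y⁆ (m + n) +
      (if m + n = 0 then (m : ℂ) * normalizedKillingForm 𝔤 t x y else 0) • central 𝔤 t := by
  refine (LieAlgebra.bracket_ofTwoCocycle (c := affineCocycle 𝔤 t) _ _).trans ?_
  simp only [mode, central]
  erw [← LieAlgebra.of_smul, ← LieAlgebra.of_add]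
  congr 1
  refine Prod.ext ?_ ?_
  · simp only [Equiv.symm_apply_apply, Prod.fst_add, Prod.smul_fst, smul_zero, add_zero,
      LieAlgebra.ExtendScalars.bracket_tmul, AddMonoidAlgebra.single_mul_single, mul_one]
  · simp only [Equiv.symm_apply_apply, lie_zero, sub_zero, add_zero, Prod.snd_add, Prod.smul_snd,
      zero_add]
    change (-1 : ℂ) • LieAlgebra.LoopAlgebra.residuePairing ℂ ℤ 𝔤 (normalizedKillingForm 𝔤 t)
      (AddMonoidAlgebra.single m 1 ⊗ₜ[ℂ] x) (AddMonoidAlgebra.single n 1 ⊗ₜ[ℂ] y) =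
      (if m + n = 0 then (m : ℂ) * normalizedKillingForm 𝔤 t x y else 0) • (1 : ℂ)
    simp only [LieAlgebra.LoopAlgebra.residuePairing_apply_apply,
      LieAlgebra.LoopAlgebra.toFinsupp_single_tmul]
    rw [Finsupp.sum_single_index (by simp)]
    by_cases h : m + n = 0
    · obtain rfl : n = -m := by omega
      simp
    · rw [Finsupp.single_eq_of_ne (by omega)]
      simp [h]

theorem lie_central {𝔤 : Type*} [LieRing 𝔤] [LieAlgebra ℂ 𝔤] {t : 𝔤}
    (y : AffineLieAlgebra 𝔤 t) : ⁅y, central 𝔤 t⁆ = 0 := by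
  refine (LieAlgebra.bracket_ofTwoCocycle (c := affineCocycle 𝔤 t) _ _).trans ?_
  simp only [central, Equiv.symm_apply_apply, lie_zero, map_zero, trivial_lie_zero,
    sub_zero, add_zero]
  rfl

/-! ### Induced modules -/

/-- The universal enveloping algebra of the affine Lie algebra. -/
abbrev EnvelopingAlgebra (𝔤 : Type*) [LieRing 𝔤] [LieAlgebra ℂ 𝔤] (t : 𝔤) : Type _ :=
  UniversalEnvelopingAlgebra ℂ (AffineLieAlgebra 𝔤 t)

/-- The image of `x(n)` in the universal enveloping algebra of the affine Lie algebra. -/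
def envMode {𝔤 : Type*} [LieRing 𝔤] [LieAlgebra ℂ 𝔤] {t : 𝔤} (x : 𝔤) (n : ℤ) :
    EnvelopingAlgebra 𝔤 t :=
  UniversalEnvelopingAlgebra.ι ℂ (mode x n : AffineLieAlgebra 𝔤 t)

/-- The `𝒰(ĝ)`-submodule of `𝒰(ĝ) ⊗_ℂ U` by which one divides in order to get the tensor product
over `𝒰(𝔤 ⊕ ℂ K ⊕ ĝ₊)`, where `𝔤 = 𝔤 ⊗ t⁰` acts on `U` as given, `ĝ₊ = 𝔤 ⊗ t ℂ[t]` acts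
trivially and `K` acts as the scalar `k`: it is generated by the elements
`y ⊗ u - 1 ⊗ y u` with `y` in a spanning set of `𝔤 ⊕ ℂ K ⊕ ĝ₊`. -/
def inducedRelations (𝔤 : Type*) [LieRing 𝔤] [LieAlgebra ℂ 𝔤] (t : 𝔤) (k : ℂ)
    (U : Type*) [AddCommGroup U] [Module ℂ U] [LieRingModule 𝔤 U] [LieModule ℂ 𝔤 U] :
    Submodule (EnvelopingAlgebra 𝔤 t) (EnvelopingAlgebra 𝔤 t ⊗[ℂ] U) :=
  Submodule.span (EnvelopingAlgebra 𝔤 t)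
    ({z | ∃ (x : 𝔤) (u : U), z = envMode x 0 ⊗ₜ[ℂ] u - 1 ⊗ₜ[ℂ] ⁅x, u⁆} ∪
      {z | ∃ (x : 𝔤) (n : ℤ) (u : U), 0 < n ∧ z = envMode x n ⊗ₜ[ℂ] u} ∪
      {z | ∃ u : U, z = UniversalEnvelopingAlgebra.ι ℂ (central 𝔤 t) ⊗ₜ[ℂ] u -
        1 ⊗ₜ[ℂ] (k • u)})

/-- The induced module `N(k, U) = 𝒰(ĝ) ⊗_{𝒰(𝔤 ⊕ ℂ K ⊕ ĝ₊)} U`. -/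
abbrev InducedModule (𝔤 : Type*) [LieRing 𝔤] [LieAlgebra ℂ 𝔤] (t : 𝔤) (k : ℂ)
    (U : Type*) [AddCommGroup U] [Module ℂ U] [LieRingModule 𝔤 U] [LieModule ℂ 𝔤 U] : Type _ :=
  (EnvelopingAlgebra 𝔤 t ⊗[ℂ] U) ⧸ inducedRelations 𝔤 t k U

/-- The module `N(k, 0)`, induced from the trivial one-dimensional `𝔤`-module. -/
abbrev VacuumModule (𝔤 : Type*) [LieRing 𝔤] [LieAlgebra ℂ 𝔤] (t : 𝔤) (k : ℂ) : Type _ :=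
  InducedModule 𝔤 t k (TrivialLieModule ℂ 𝔤 ℂ)

/-- The vector `𝟏 = 1 ⊗ 1` of `N(k, 0)`. -/
def vacuum (𝔤 : Type*) [LieRing 𝔤] [LieAlgebra ℂ 𝔤] (t : 𝔤) (k : ℂ) : VacuumModule 𝔤 t k :=
  (inducedRelations 𝔤 t k (TrivialLieModule ℂ 𝔤 ℂ)).mkQ
    ((1 : EnvelopingAlgebra 𝔤 t) ⊗ₜ[ℂ] (TrivialLieModule.equiv ℂ 𝔤 ℂ).symm 1)

/-! ### Singular vectors

Here `𝔤` comes with Chevalley generators `b.e i`, `b.h i`, `b.f i`, and the Cartan subalgebra `𝔥`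
spanned by the `b.h i`. -/

section Singular

variable {ι 𝔤 : Type*} [Finite ι] [LieRing 𝔤] [LieAlgebra ℂ 𝔤] {𝔥 : LieSubalgebra ℂ 𝔤}

/-- The Cartan subalgebra `ĥ = 𝔥 ⊕ ℂ K` of the affine Lie algebra. -/
def affineCartan (𝔥 : LieSubalgebra ℂ 𝔤) (t : 𝔤) : Submodule ℂ (AffineLieAlgebra 𝔤 t) :=
  Submodule.span ℂ ({y | ∃ x ∈ 𝔥, y = mode x 0} ∪ {central 𝔤 t})

/-- The subalgebra `n̂₊ = 𝔫₊ ⊕ 𝔤 ⊗ t ℂ[t]` of the affine Lie algebra, where `𝔫₊` is the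
subalgebra of `𝔤` generated by the `b.e i`. -/
def affineNPlus (b : LieAlgebra.Basis ι 𝔥) (t : 𝔤) : Submodule ℂ (AffineLieAlgebra 𝔤 t) :=
  Submodule.span ℂ
    ({y | ∃ x ∈ LieSubalgebra.lieSpan ℂ 𝔤 (Set.range b.e), y = mode x 0} ∪
      {y | ∃ (x : 𝔤) (n : ℤ), 0 < n ∧ y = mode x n})

/-- A weight vector: a nonzero vector which is a simultaneous eigenvector of `ĥ`. -/
def IsWeightVector (𝔥 : LieSubalgebra ℂ 𝔤) {t : 𝔤} {k : ℂ} (v : VacuumModule 𝔤 t k) : Prop :=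
  v ≠ 0 ∧ ∃ μ : Module.Dual ℂ (affineCartan 𝔥 t), ∀ y : affineCartan 𝔥 t,
    UniversalEnvelopingAlgebra.ι ℂ (y : AffineLieAlgebra 𝔤 t) • v = μ y • v

/-- A singular vector: a weight vector which is annihilated by `n̂₊`. -/
def IsSingularVector (b : LieAlgebra.Basis ι 𝔥) {t : 𝔤} {k : ℂ} (v : VacuumModule 𝔤 t k) : Prop :=
  IsWeightVector 𝔥 v ∧
    ∀ y ∈ affineNPlus b t, UniversalEnvelopingAlgebra.ι ℂ (y : AffineLieAlgebra 𝔤 t) • v = 0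

end Singular

/-! ### Root vectors of type `G₂`

Index `0` stands for the short simple root `α`, index `1` for the long simple root `β`. -/

section RootVectors

variable {𝔤 : Type*} [LieRing 𝔤] [LieAlgebra ℂ 𝔤] {𝔥 : LieSubalgebra ℂ 𝔤}
  (b : LieAlgebra.Basis (Fin 2) 𝔥)

def E10 : 𝔤 := b.e 0
def E01 : 𝔤 := b.e 1
def E11 : 𝔤 := ⁅E10 b, E01 b⁆
def E21 : 𝔤 := (1 / 2 : ℂ) • ⁅E11 b, E10 b⁆
def E31 : 𝔤 := (1 / 3 : ℂ) • ⁅E21 b, E10 b⁆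
def E32 : 𝔤 := ⁅E31 b, E01 b⁆
def F10 : 𝔤 := b.f 0
def F01 : 𝔤 := b.f 1
def F11 : 𝔤 := ⁅F01 b, F10 b⁆
def F21 : 𝔤 := (1 / 2 : ℂ) • ⁅F10 b, F11 b⁆
def F31 : 𝔤 := (1 / 3 : ℂ) • ⁅F10 b, F21 b⁆
def F32 : 𝔤 := ⁅F01 b, F31 b⁆
def H01 : 𝔤 := ⁅E01 b, F01 b⁆

/-- The coroot of the highest root `θ = 3α + 2β`. -/
def H32 : 𝔤 := ⁅E32 b, F32 b⁆

/-! ### The elements `a, b, c, w, u, v` of `𝒰(ĝ)`  -/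

def elemA : EnvelopingAlgebra 𝔤 (H32 b) := envMode (E21 b) (-1)

def elemB : EnvelopingAlgebra 𝔤 (H32 b) :=
  envMode (E31 b) (-1) * envMode (E11 b) (-1) - envMode (E32 b) (-1) * envMode (E10 b) (-1)

def elemC : EnvelopingAlgebra 𝔤 (H32 b) :=
  envMode (E31 b) (-1) ^ 2 * envMode (E01 b) (-1)
    - envMode (E32 b) (-1) * envMode (E31 b) (-1) * envMode (H01 b) (-1)
    - envMode (E32 b) (-1) ^ 2 * envMode (F01 b) (-1)

def elemW : EnvelopingAlgebra 𝔤 (H32 b) :=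
  envMode (E31 b) (-1) * envMode (E32 b) (-2) - envMode (E32 b) (-1) * envMode (E31 b) (-2)

def elemU : EnvelopingAlgebra 𝔤 (H32 b) :=
  (1 / 3 : ℂ) • elemA b ^ 2 - elemB b

def elemV : EnvelopingAlgebra 𝔤 (H32 b) :=
  (2 / 9 : ℂ) • elemA b ^ 3 - elemA b * elemB b - (3 : ℂ) • elemC b

end RootVectors

end AffineG2

end

/-! A vector killed by `E10(0)`, `E01(0)` and `F32(1)` is killed by all of `n̂₊`. The first two
operators generate the action of `𝔫₊`. Bracketing with them climbs from the lowest root vector `F32`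
to every root vector and coroot, so all of `𝔤 ⊗ t` annihilates. Since `𝔤 = [𝔤, 𝔤]`, the higher modes
follow by induction (`modeAction_one_eq_zero`, `modeAction_pos_eq_zero`).

The operators `u`, `v`, `w` commute with `E10(0)` and `E01(0)` at every level. Under the `sl₂` of
`β`, the pairs `E10, E11` and `E31, E32` are doublets, and `b` and `w` are determinants built from
them. Under `E10(0)` one has `a ↦ -3 E31(-1)`, `b ↦ -2 E31(-1) a`, `c ↦ E31(-1) b`, which dictates
the coefficients of `u` and `v`. The level enters only through `F32(1)`, because `(F32, E32) = 1`.
For instance `F32(1) u 𝟏 = (k + 5/3) E10(-1) 𝟏`. These checks are commutator calculations based on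
the multiplication table of `G₂`.

Nonvanishing needs a lower bound on the size of `N(k, 0)`. Instead of the Poincaré–Birkhoff–Witt
theorem, an action of the affine algebra is built directly on the enveloping algebra of `𝔤 ⊗
t⁻¹ℂ[t⁻¹]` (`extendedAction_lie`, `realization`). Evaluation at `1` factors through `N(k, 0)`, and a
character of the negative part then separates the vectors from zero. The character kills `E31(-1)`,
`E32(-1)` and all `x(-2)`, but not `E21(-1)`, so only the powers of `a` survive
(`exists_functional_elem`). -/

set_option linter.unusedSimpArgs false

open scoped TensorProduct

noncomputable section

namespace AffineG2

/-! ### The Lie algebra of type `G₂` in terms of its Chevalley generators. -/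

section RootSystem

variable {𝔤 : Type*} [LieRing 𝔤] [LieAlgebra ℂ 𝔤] {𝔥 : LieSubalgebra ℂ 𝔤}

/-- The Chevalley generators `b` have Cartan matrix of type `G₂`, the index `0` standing for the
short simple root. -/
class IsTypeG2 (b : LieAlgebra.Basis (Fin 2) 𝔥) : Prop where
  cartanMatrix_eq : b.A = !![2, -1; -3, 2]

variable (b : LieAlgebra.Basis (Fin 2) 𝔥)

def H10 : 𝔤 := b.h 0

theorem H01_eq : H01 b = b.h 1 := (b.sl2 1).lie_e_f

/-- `b.symm` interchanges `e` and `f` and negates `h`. As the Cartan matrix is unchanged, every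
relation proved for the `E`'s yields one for the `F`'s, up to the signs recorded in the `_symm`
lemmas. -/
instance [hb : IsTypeG2 b] : IsTypeG2 b.symm := ⟨hb.cartanMatrix_eq⟩

/-! ### Relations between Chevalley generators -/

theorem H10_symm : H10 b.symm = -H10 b := rfl

theorem H01_symm : H01 b.symm = -H01 b := by
  rw [H01_eq, H01_eq]; rfl

theorem E11_symm : E11 b.symm = -F11 b := (lie_skew _ _).symm

theorem F11_symm : F11 b.symm = -E11 b := (lie_skew _ _).symm

theorem E21_symm : E21 b.symm = F21 b := by
  rw [E21, E11_symm, neg_lie, lie_skew]; rfl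

theorem F21_symm : F21 b.symm = E21 b := by
  rw [F21, F11_symm, lie_neg, lie_skew]; rfl

theorem E31_symm : E31 b.symm = -F31 b := by
  rw [E31, E21_symm, ← lie_skew, smul_neg]; rfl

theorem F31_symm : F31 b.symm = -E31 b := by
  rw [F31, F21_symm, ← lie_skew, smul_neg]; rfl

theorem E32_symm : E32 b.symm = F32 b := by
  rw [E32, E31_symm, neg_lie, lie_skew]; rfl

theorem E10_symm : E10 b.symm = F10 b := rfl

theorem F10_symm : F10 b.symm = E10 b := rfl

theorem E01_symm : E01 b.symm = F01 b := rfl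

theorem F01_symm : F01 b.symm = E01 b := rfl

theorem lie_H10_H01 : ⁅H10 b, H01 b⁆ = 0 := by
  rw [H01_eq]; exact b.lie_h_h 0 1

theorem lie_E10_F10 : ⁅E10 b, F10 b⁆ = H10 b := (b.sl2 0).lie_e_f

theorem lie_E10_F01 : ⁅E10 b, F01 b⁆ = 0 := b.lie_e_f_ne 0 1 (by decide)

theorem lie_E01_F10 : ⁅E01 b, F10 b⁆ = 0 := b.lie_e_f_ne 1 0 (by decide)

theorem lie_E10_E11 : ⁅E10 b, E11 b⁆ = (-2 : ℂ) • E21 b := by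
  rw [E21, ← lie_skew, smul_smul]; norm_num

theorem lie_E10_E21 : ⁅E10 b, E21 b⁆ = (-3 : ℂ) • E31 b := by
  rw [E31, ← lie_skew, smul_smul]; norm_num

/-- The Serre relation `(ad eᵢ)ⁿ⁺¹ eⱼ = 0`, where `n = - αⱼ(hᵢ)`. -/
theorem toEnd_e_pow_e_eq_zero [FiniteDimensional ℂ 𝔤] {i j : Fin 2} (hij : j ≠ i) {n : ℕ}
    (hn : b.A j i = -n) : (LieModule.toEnd ℂ 𝔤 𝔤 (b.e i) ^ (n + 1)) (b.e j) = 0 := by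
  -- In the triple with `e i` and `f i` exchanged, `e j` is a highest weight vector of weight `n`,
  -- and `e i` is the lowering operator. Finite dimension then forces the `(n + 1)`-st power to kill
  -- it.
  have P : (b.sl2 i).symm.HasPrimitiveVectorWith (b.e j) (n : ℂ) :=
    { ne_zero := (b.sl2 j).e_ne_zero
      lie_h := by rw [neg_lie, b.lie_h_e, hn]; simp [Nat.cast_smul_eq_nsmul]
      lie_e := by rw [← lie_skew, b.lie_e_f_ne j i hij, neg_zero] }
  exact P.pow_toEnd_f_eq_zero_of_eq_nat rfl

/-! ### The action of the Chevalley generators on the positive root vectors -/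

section PositiveRootVectors

variable [hb : IsTypeG2 b]

theorem lie_H10_pos :
    ⁅H10 b, E10 b⁆ = (2 : ℂ) • E10 b ∧ ⁅H10 b, E01 b⁆ = (-3 : ℂ) • E01 b ∧
    ⁅H10 b, E11 b⁆ = -E11 b ∧ ⁅H10 b, E21 b⁆ = E21 b ∧ ⁅H10 b, E31 b⁆ = (3 : ℂ) • E31 b ∧
    ⁅H10 b, E32 b⁆ = 0 := by
  have h10 : ⁅H10 b, E10 b⁆ = (2 : ℂ) • E10 b := by
    simpa [hb.cartanMatrix_eq, ← Int.cast_smul_eq_zsmul ℂ] using! b.lie_h_e 0 0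
  have h01 : ⁅H10 b, E01 b⁆ = (-3 : ℂ) • E01 b := by
    simpa [hb.cartanMatrix_eq, ← Int.cast_smul_eq_zsmul ℂ] using! b.lie_h_e 1 0
  have h11 : ⁅H10 b, E11 b⁆ = -E11 b := by
    rw [E11, leibniz_lie, h10, h01, lie_smul, smul_lie]; module
  have h21 : ⁅H10 b, E21 b⁆ = E21 b := by
    rw [E21, lie_smul, leibniz_lie, h10, h11, lie_smul, neg_lie]; module
  have h31 : ⁅H10 b, E31 b⁆ = (3 : ℂ) • E31 b := by
    rw [E31, lie_smul, leibniz_lie, h10, h21, lie_smul]; module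
  have h32 : ⁅H10 b, E32 b⁆ = 0 := by
    rw [E32, leibniz_lie, h31, h01, lie_smul, smul_lie]; module
  exact ⟨h10, h01, h11, h21, h31, h32⟩

theorem lie_H01_pos :
    ⁅H01 b, E10 b⁆ = -E10 b ∧ ⁅H01 b, E01 b⁆ = (2 : ℂ) • E01 b ∧ ⁅H01 b, E11 b⁆ = E11 b ∧
    ⁅H01 b, E21 b⁆ = 0 ∧ ⁅H01 b, E31 b⁆ = -E31 b ∧ ⁅H01 b, E32 b⁆ = E32 b := by
  have h10 : ⁅H01 b, E10 b⁆ = -E10 b := by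
    simpa [hb.cartanMatrix_eq, ← Int.cast_smul_eq_zsmul ℂ, H01_eq] using! b.lie_h_e 0 1
  have h01 : ⁅H01 b, E01 b⁆ = (2 : ℂ) • E01 b := by
    simpa [hb.cartanMatrix_eq, ← Int.cast_smul_eq_zsmul ℂ, H01_eq] using! b.lie_h_e 1 1
  have h11 : ⁅H01 b, E11 b⁆ = E11 b := by
    rw [E11, leibniz_lie, h10, h01, lie_smul, neg_lie]; module
  have h21 : ⁅H01 b, E21 b⁆ = 0 := by
    rw [E21, lie_smul, leibniz_lie, h10, h11, lie_neg]; module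
  have h31 : ⁅H01 b, E31 b⁆ = -E31 b := by
    rw [E31, lie_smul, leibniz_lie, h10, h21, lie_neg, zero_lie]; module
  have h32 : ⁅H01 b, E32 b⁆ = E32 b := by
    rw [E32, leibniz_lie, h31, h01, lie_smul, neg_lie]; module
  exact ⟨h10, h01, h11, h21, h31, h32⟩

theorem lie_F01_pos :
    ⁅F01 b, E10 b⁆ = 0 ∧ ⁅F01 b, E01 b⁆ = -H01 b ∧ ⁅F01 b, E11 b⁆ = -E10 b ∧ ⁅F01 b, E21 b⁆ = 0 ∧
    ⁅F01 b, E31 b⁆ = 0 ∧ ⁅F01 b, E32 b⁆ = -E31 b := by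
  obtain ⟨k10, k01, k11, k21, k31, -⟩ := lie_H01_pos b
  have h10 : ⁅F01 b, E10 b⁆ = 0 := by rw [← lie_skew, lie_E10_F01, neg_zero]
  have h01 : ⁅F01 b, E01 b⁆ = -H01 b := (lie_skew _ _).symm
  have h11 : ⁅F01 b, E11 b⁆ = -E10 b := by
    rw [E11, leibniz_lie, h10, h01, lie_neg, ← lie_skew (E10 b), k10, zero_lie]; module
  have h21 : ⁅F01 b, E21 b⁆ = 0 := by
    rw [E21, lie_smul, leibniz_lie, h10, h11, neg_lie, lie_self]; simp
  have h31 : ⁅F01 b, E31 b⁆ = 0 := by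
    rw [E31, lie_smul, leibniz_lie, h10, h21]; simp
  have h32 : ⁅F01 b, E32 b⁆ = -E31 b := by
    rw [E32, leibniz_lie, h31, h01, lie_neg, ← lie_skew (E31 b), k31, zero_lie]; module
  exact ⟨h10, h01, h11, h21, h31, h32⟩

variable [FiniteDimensional ℂ 𝔤]

theorem lie_E01_E11 : ⁅E01 b, E11 b⁆ = 0 := by
  have h := toEnd_e_pow_e_eq_zero b (i := 1) (j := 0) (by decide) (n := 1)
    (by simp [hb.cartanMatrix_eq])
  simp only [pow_succ, pow_zero, one_mul, Module.End.mul_apply, LieModule.toEnd_apply_apply] at h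
  rw [E11, ← lie_skew (E10 b), lie_neg]
  exact neg_eq_zero.mpr h

theorem lie_E10_E31 : ⁅E10 b, E31 b⁆ = 0 := by
  have h := toEnd_e_pow_e_eq_zero b (i := 0) (j := 1) (by decide) (n := 3)
    (by simp [hb.cartanMatrix_eq])
  simp only [pow_succ, pow_zero, one_mul, Module.End.mul_apply, LieModule.toEnd_apply_apply] at h
  -- The left side is `(-2)(-3) [E10, E31] = 6 [E10, E31]`.
  change ⁅E10 b, ⁅E10 b, ⁅E10 b, E11 b⁆⁆⁆ = 0 at h
  simpa [lie_E10_E11, lie_E10_E21, smul_smul] using h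

theorem lie_E01_E21 : ⁅E01 b, E21 b⁆ = 0 := by
  rw [E21, lie_smul, leibniz_lie, lie_E01_E11, ← lie_skew (E01 b), ← E11]
  simp

theorem lie_E11_E21 : ⁅E11 b, E21 b⁆ = (-3 : ℂ) • E32 b := by
  rw [E11, lie_lie, lie_E01_E21, lie_E10_E21, lie_zero, lie_smul, ← lie_skew (E01 b), ← E32]
  module

theorem lie_E10_E32 : ⁅E10 b, E32 b⁆ = ⁅E31 b, E11 b⁆ := by
  rw [E32, leibniz_lie, lie_E10_E31, zero_lie, zero_add, ← E11]

/-- Applying `ad E10` to `[E11, E21] = -3 E32` gives `3 [E11, E31]` on one side and `-3 [E11, E31]`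
on the other. -/
theorem lie_E11_E31 : ⁅E11 b, E31 b⁆ = 0 := by
  have h := leibniz_lie (E10 b) (E11 b) (E21 b)
  rw [lie_E11_E21, lie_smul, lie_E10_E32, ← lie_skew (E31 b), lie_E10_E11, smul_lie, lie_self,
    lie_E10_E21, lie_smul] at h
  have h' : (6 : ℂ) • ⁅E11 b, E31 b⁆ = 0 := by
    rw [← sub_eq_zero.mpr h]; module
  simpa using h'

theorem lie_E01_E32 : ⁅E01 b, E32 b⁆ = 0 := by
  have h := leibniz_lie (E01 b) (E11 b) (E21 b)
  simpa [lie_E11_E21, lie_E01_E11, lie_E01_E21] using h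

theorem lie_E10_pos :
    ⁅E10 b, E10 b⁆ = 0 ∧ ⁅E10 b, E01 b⁆ = E11 b ∧ ⁅E10 b, E11 b⁆ = (-2 : ℂ) • E21 b ∧
    ⁅E10 b, E21 b⁆ = (-3 : ℂ) • E31 b ∧ ⁅E10 b, E31 b⁆ = 0 ∧ ⁅E10 b, E32 b⁆ = 0 :=
  ⟨lie_self _, rfl, lie_E10_E11 b, lie_E10_E21 b, lie_E10_E31 b, by
    rw [lie_E10_E32, ← lie_skew, lie_E11_E31, neg_zero]⟩

theorem lie_E01_pos :
    ⁅E01 b, E10 b⁆ = -E11 b ∧ ⁅E01 b, E01 b⁆ = 0 ∧ ⁅E01 b, E11 b⁆ = 0 ∧ ⁅E01 b, E21 b⁆ = 0 ∧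
    ⁅E01 b, E31 b⁆ = -E32 b ∧ ⁅E01 b, E32 b⁆ = 0 :=
  ⟨(lie_skew _ _).symm, lie_self _, lie_E01_E11 b, lie_E01_E21 b, (lie_skew _ _).symm,
    lie_E01_E32 b⟩

theorem lie_F10_pos :
    ⁅F10 b, E10 b⁆ = -H10 b ∧ ⁅F10 b, E01 b⁆ = 0 ∧ ⁅F10 b, E11 b⁆ = (3 : ℂ) • E01 b ∧
    ⁅F10 b, E21 b⁆ = (-2 : ℂ) • E11 b ∧ ⁅F10 b, E31 b⁆ = -E21 b ∧ ⁅F10 b, E32 b⁆ = 0 := by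
  obtain ⟨k10, k01, k11, k21, -, -⟩ := lie_H10_pos b
  have h10 : ⁅F10 b, E10 b⁆ = -H10 b := by rw [← lie_skew, lie_E10_F10]
  have h01 : ⁅F10 b, E01 b⁆ = 0 := by rw [← lie_skew, lie_E01_F10, neg_zero]
  have h11 : ⁅F10 b, E11 b⁆ = (3 : ℂ) • E01 b := by
    rw [E11, leibniz_lie, h10, h01, neg_lie, k01, lie_zero]; module
  have h21 : ⁅F10 b, E21 b⁆ = (-2 : ℂ) • E11 b := by
    rw [E21, lie_smul, leibniz_lie, h10, h11, lie_neg, ← lie_skew (E11 b), k11, smul_lie,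
      ← lie_skew, ← E11]
    module
  have h31 : ⁅F10 b, E31 b⁆ = -E21 b := by
    rw [E31, lie_smul, leibniz_lie, h10, h21, lie_neg, ← lie_skew (E21 b), k21, smul_lie,
      ← lie_skew (E11 b), lie_E10_E11]
    module
  have h32 : ⁅F10 b, E32 b⁆ = 0 := by
    rw [E32, leibniz_lie, h31, h01, neg_lie, lie_zero, lie_skew, lie_E01_E21, add_zero]
  exact ⟨h10, h01, h11, h21, h31, h32⟩

end PositiveRootVectors

/-! ### The multiplication table -/

section MultiplicationTable

variable [IsTypeG2 b]

theorem lie_H10 :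
    ⁅H10 b, E10 b⁆ = (2 : ℂ) • E10 b ∧ ⁅H10 b, E01 b⁆ = (-3 : ℂ) • E01 b ∧
    ⁅H10 b, E11 b⁆ = -E11 b ∧ ⁅H10 b, E21 b⁆ = E21 b ∧ ⁅H10 b, E31 b⁆ = (3 : ℂ) • E31 b ∧
    ⁅H10 b, E32 b⁆ = 0 ∧ ⁅H10 b, H10 b⁆ = 0 ∧ ⁅H10 b, H01 b⁆ = 0 ∧
    ⁅H10 b, F10 b⁆ = (-2 : ℂ) • F10 b ∧ ⁅H10 b, F01 b⁆ = (3 : ℂ) • F01 b ∧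
    ⁅H10 b, F11 b⁆ = F11 b ∧ ⁅H10 b, F21 b⁆ = -F21 b ∧ ⁅H10 b, F31 b⁆ = (-3 : ℂ) • F31 b ∧
    ⁅H10 b, F32 b⁆ = 0 := by
  have h := lie_H10_pos b
  have h' := lie_H10_pos b.symm
  simp only [E10_symm, E01_symm, E11_symm, E21_symm, E31_symm, E32_symm, H10_symm, H01_symm,
    F10_symm, F01_symm, neg_lie, lie_neg, neg_neg, smul_neg, neg_inj, neg_eq_zero, neg_zero,
    neg_eq_iff_eq_neg] at h'
  obtain ⟨h10, h01, h11, h21, h31, h32⟩ := h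
  obtain ⟨k10, k01, k11, k21, k31, k32⟩ := h'
  refine ⟨h10, h01, h11, h21, h31, h32, lie_self _, lie_H10_H01 b,
    ?_, ?_, ?_, ?_, ?_, ?_⟩ <;>
  simp only [k10, k01, k11, k21, k31, k32] <;> module

theorem lie_H01 :
    ⁅H01 b, E10 b⁆ = -E10 b ∧ ⁅H01 b, E01 b⁆ = (2 : ℂ) • E01 b ∧ ⁅H01 b, E11 b⁆ = E11 b ∧
    ⁅H01 b, E21 b⁆ = 0 ∧ ⁅H01 b, E31 b⁆ = -E31 b ∧ ⁅H01 b, E32 b⁆ = E32 b ∧ ⁅H01 b, H10 b⁆ = 0 ∧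
    ⁅H01 b, H01 b⁆ = 0 ∧ ⁅H01 b, F10 b⁆ = F10 b ∧ ⁅H01 b, F01 b⁆ = (-2 : ℂ) • F01 b ∧
    ⁅H01 b, F11 b⁆ = -F11 b ∧ ⁅H01 b, F21 b⁆ = 0 ∧ ⁅H01 b, F31 b⁆ = F31 b ∧
    ⁅H01 b, F32 b⁆ = -F32 b := by
  have h := lie_H01_pos b
  have h' := lie_H01_pos b.symm
  simp only [E10_symm, E01_symm, E11_symm, E21_symm, E31_symm, E32_symm, H10_symm, H01_symm,
    F10_symm, F01_symm, neg_lie, lie_neg, neg_neg, smul_neg, neg_inj, neg_eq_zero, neg_zero,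
    neg_eq_iff_eq_neg] at h'
  obtain ⟨h10, h01, h11, h21, h31, h32⟩ := h
  obtain ⟨k10, k01, k11, k21, k31, k32⟩ := h'
  refine ⟨h10, h01, h11, h21, h31, h32, by rw [← lie_skew, lie_H10_H01, neg_zero], lie_self _,
    ?_, ?_, ?_, ?_, ?_, ?_⟩ <;>
  simp only [k10, k01, k11, k21, k31, k32]; module

variable [FiniteDimensional ℂ 𝔤]

theorem lie_E10 :
    ⁅E10 b, E10 b⁆ = 0 ∧ ⁅E10 b, E01 b⁆ = E11 b ∧ ⁅E10 b, E11 b⁆ = (-2 : ℂ) • E21 b ∧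
    ⁅E10 b, E21 b⁆ = (-3 : ℂ) • E31 b ∧ ⁅E10 b, E31 b⁆ = 0 ∧ ⁅E10 b, E32 b⁆ = 0 ∧
    ⁅E10 b, H10 b⁆ = (-2 : ℂ) • E10 b ∧ ⁅E10 b, H01 b⁆ = E10 b ∧ ⁅E10 b, F10 b⁆ = H10 b ∧
    ⁅E10 b, F01 b⁆ = 0 ∧ ⁅E10 b, F11 b⁆ = (-3 : ℂ) • F01 b ∧ ⁅E10 b, F21 b⁆ = (2 : ℂ) • F11 b ∧
    ⁅E10 b, F31 b⁆ = F21 b ∧ ⁅E10 b, F32 b⁆ = 0 := by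
  have h := lie_E10_pos b
  have h' := lie_F10_pos b.symm
  simp only [E10_symm, E01_symm, E11_symm, E21_symm, E31_symm, E32_symm, H10_symm, H01_symm,
    F10_symm, F01_symm, neg_lie, lie_neg, neg_neg, smul_neg, neg_inj, neg_eq_zero, neg_zero,
    neg_eq_iff_eq_neg] at h'
  obtain ⟨h10, h01, h11, h21, h31, h32⟩ := h
  obtain ⟨k10, k01, k11, k21, k31, k32⟩ := h'
  have hH10 := (lie_H10 b).1
  have hH01 := (lie_H01 b).1
  refine ⟨h10, h01, h11, h21, h31, h32, ?_, ?_, ?_, ?_, ?_, ?_, ?_, ?_⟩ <;>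
  simp only [← lie_skew (E10 b) (H10 b), ← lie_skew (E10 b) (H01 b), hH10, hH01, k10, k01, k11, k21,
    k31, k32] <;> module

theorem lie_E01 :
    ⁅E01 b, E10 b⁆ = -E11 b ∧ ⁅E01 b, E01 b⁆ = 0 ∧ ⁅E01 b, E11 b⁆ = 0 ∧ ⁅E01 b, E21 b⁆ = 0 ∧
    ⁅E01 b, E31 b⁆ = -E32 b ∧ ⁅E01 b, E32 b⁆ = 0 ∧ ⁅E01 b, H10 b⁆ = (3 : ℂ) • E01 b ∧
    ⁅E01 b, H01 b⁆ = (-2 : ℂ) • E01 b ∧ ⁅E01 b, F10 b⁆ = 0 ∧ ⁅E01 b, F01 b⁆ = H01 b ∧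
    ⁅E01 b, F11 b⁆ = F10 b ∧ ⁅E01 b, F21 b⁆ = 0 ∧ ⁅E01 b, F31 b⁆ = 0 ∧ ⁅E01 b, F32 b⁆ = F31 b := by
  have h := lie_E01_pos b
  have h' := lie_F01_pos b.symm
  simp only [E10_symm, E01_symm, E11_symm, E21_symm, E31_symm, E32_symm, H10_symm, H01_symm,
    F10_symm, F01_symm, neg_lie, lie_neg, neg_neg, smul_neg, neg_inj, neg_eq_zero, neg_zero,
    neg_eq_iff_eq_neg] at h'
  obtain ⟨h10, h01, h11, h21, h31, h32⟩ := h
  obtain ⟨k10, k01, k11, k21, k31, k32⟩ := h'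
  have hH10 := (lie_H10 b).2.1
  have hH01 := (lie_H01 b).2.1
  refine ⟨h10, h01, h11, h21, h31, h32, ?_, ?_, ?_, ?_, ?_, ?_, ?_, ?_⟩ <;>
  simp only [← lie_skew (E01 b) (H10 b), ← lie_skew (E01 b) (H01 b), hH10, hH01, k10, k01, k11, k21,
    k31, k32] <;> module

theorem lie_F10 :
    ⁅F10 b, E10 b⁆ = -H10 b ∧ ⁅F10 b, E01 b⁆ = 0 ∧ ⁅F10 b, E11 b⁆ = (3 : ℂ) • E01 b ∧
    ⁅F10 b, E21 b⁆ = (-2 : ℂ) • E11 b ∧ ⁅F10 b, E31 b⁆ = -E21 b ∧ ⁅F10 b, E32 b⁆ = 0 ∧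
    ⁅F10 b, H10 b⁆ = (2 : ℂ) • F10 b ∧ ⁅F10 b, H01 b⁆ = -F10 b ∧ ⁅F10 b, F10 b⁆ = 0 ∧
    ⁅F10 b, F01 b⁆ = -F11 b ∧ ⁅F10 b, F11 b⁆ = (2 : ℂ) • F21 b ∧
    ⁅F10 b, F21 b⁆ = (3 : ℂ) • F31 b ∧ ⁅F10 b, F31 b⁆ = 0 ∧ ⁅F10 b, F32 b⁆ = 0 := by
  have h := lie_F10_pos b
  have h' := lie_E10_pos b.symm
  simp only [E10_symm, E01_symm, E11_symm, E21_symm, E31_symm, E32_symm, H10_symm, H01_symm,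
    F10_symm, F01_symm, neg_lie, lie_neg, neg_neg, smul_neg, neg_inj, neg_eq_zero, neg_zero,
    neg_eq_iff_eq_neg] at h'
  obtain ⟨h10, h01, h11, h21, h31, h32⟩ := h
  obtain ⟨k10, k01, k11, k21, k31, k32⟩ := h'
  have hH10 := (lie_H10 b).2.2.2.2.2.2.2.2.1
  have hH01 := (lie_H01 b).2.2.2.2.2.2.2.2.1
  refine ⟨h10, h01, h11, h21, h31, h32, ?_, ?_, ?_, ?_, ?_, ?_, ?_, ?_⟩ <;>
  simp only [← lie_skew (F10 b) (H10 b), ← lie_skew (F10 b) (H01 b), hH10, hH01, k10, k01, k11, k21,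
    k31, k32] <;> module

theorem lie_F01 :
    ⁅F01 b, E10 b⁆ = 0 ∧ ⁅F01 b, E01 b⁆ = -H01 b ∧ ⁅F01 b, E11 b⁆ = -E10 b ∧ ⁅F01 b, E21 b⁆ = 0 ∧
    ⁅F01 b, E31 b⁆ = 0 ∧ ⁅F01 b, E32 b⁆ = -E31 b ∧ ⁅F01 b, H10 b⁆ = (-3 : ℂ) • F01 b ∧
    ⁅F01 b, H01 b⁆ = (2 : ℂ) • F01 b ∧ ⁅F01 b, F10 b⁆ = F11 b ∧ ⁅F01 b, F01 b⁆ = 0 ∧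
    ⁅F01 b, F11 b⁆ = 0 ∧ ⁅F01 b, F21 b⁆ = 0 ∧ ⁅F01 b, F31 b⁆ = F32 b ∧ ⁅F01 b, F32 b⁆ = 0 := by
  have h := lie_F01_pos b
  have h' := lie_E01_pos b.symm
  simp only [E10_symm, E01_symm, E11_symm, E21_symm, E31_symm, E32_symm, H10_symm, H01_symm,
    F10_symm, F01_symm, neg_lie, lie_neg, neg_neg, smul_neg, neg_inj, neg_eq_zero, neg_zero,
    neg_eq_iff_eq_neg] at h'
  obtain ⟨h10, h01, h11, h21, h31, h32⟩ := h
  obtain ⟨k10, k01, k11, k21, k31, k32⟩ := h'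
  have hH10 := (lie_H10 b).2.2.2.2.2.2.2.2.2.1
  have hH01 := (lie_H01 b).2.2.2.2.2.2.2.2.2.1
  refine ⟨h10, h01, h11, h21, h31, h32, ?_, ?_, ?_, ?_, ?_, ?_, ?_, ?_⟩ <;>
  simp only [← lie_skew (F01 b) (H10 b), ← lie_skew (F01 b) (H01 b), hH10, hH01, k10, k01, k11, k21,
    k31, k32] <;> module

/-- From here on each root vector is a multiple of a bracket of two vectors whose rows of the table
are known, so the Jacobi identity yields its row. -/
theorem lie_E11 :
    ⁅E11 b, E10 b⁆ = (2 : ℂ) • E21 b ∧ ⁅E11 b, E01 b⁆ = 0 ∧ ⁅E11 b, E11 b⁆ = 0 ∧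
    ⁅E11 b, E21 b⁆ = (-3 : ℂ) • E32 b ∧ ⁅E11 b, E31 b⁆ = 0 ∧ ⁅E11 b, E32 b⁆ = 0 ∧
    ⁅E11 b, H10 b⁆ = E11 b ∧ ⁅E11 b, H01 b⁆ = -E11 b ∧ ⁅E11 b, F10 b⁆ = (-3 : ℂ) • E01 b ∧
    ⁅E11 b, F01 b⁆ = E10 b ∧ ⁅E11 b, F11 b⁆ = H10 b + (3 : ℂ) • H01 b ∧
    ⁅E11 b, F21 b⁆ = (-2 : ℂ) • F10 b ∧ ⁅E11 b, F31 b⁆ = 0 ∧ ⁅E11 b, F32 b⁆ = F21 b := by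
  have h (w : 𝔤) : ⁅E11 b, w⁆ = ⁅E10 b, ⁅E01 b, w⁆⁆ - ⁅E01 b, ⁅E10 b, w⁆⁆ := by
    rw [E11, lie_lie]
  simp only [h, lie_E10 b, lie_E01 b, lie_smul, lie_neg, lie_add, lie_sub, lie_zero]
  refine ⟨?_, ?_, ?_, ?_, ?_, ?_, ?_, ?_, ?_, ?_, ?_, ?_, ?_, ?_⟩ <;> module

theorem lie_E21 :
    ⁅E21 b, E10 b⁆ = (3 : ℂ) • E31 b ∧ ⁅E21 b, E01 b⁆ = 0 ∧ ⁅E21 b, E11 b⁆ = (3 : ℂ) • E32 b ∧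
    ⁅E21 b, E21 b⁆ = 0 ∧ ⁅E21 b, E31 b⁆ = 0 ∧ ⁅E21 b, E32 b⁆ = 0 ∧ ⁅E21 b, H10 b⁆ = -E21 b ∧
    ⁅E21 b, H01 b⁆ = 0 ∧ ⁅E21 b, F10 b⁆ = (2 : ℂ) • E11 b ∧ ⁅E21 b, F01 b⁆ = 0 ∧
    ⁅E21 b, F11 b⁆ = (-2 : ℂ) • E10 b ∧ ⁅E21 b, F21 b⁆ = (2 : ℂ) • H10 b + (3 : ℂ) • H01 b ∧
    ⁅E21 b, F31 b⁆ = -F10 b ∧ ⁅E21 b, F32 b⁆ = -F11 b := by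
  have h (w : 𝔤) : ⁅E21 b, w⁆ = (1 / 2 : ℂ) • (⁅E11 b, ⁅E10 b, w⁆⁆ - ⁅E10 b, ⁅E11 b, w⁆⁆) := by
    rw [E21, smul_lie, lie_lie]
  simp only [h, lie_E11 b, lie_E10 b, lie_smul, lie_neg, lie_add, lie_sub, lie_zero]
  refine ⟨?_, ?_, ?_, ?_, ?_, ?_, ?_, ?_, ?_, ?_, ?_, ?_, ?_, ?_⟩ <;> module

theorem lie_E31 :
    ⁅E31 b, E10 b⁆ = 0 ∧ ⁅E31 b, E01 b⁆ = E32 b ∧ ⁅E31 b, E11 b⁆ = 0 ∧ ⁅E31 b, E21 b⁆ = 0 ∧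
    ⁅E31 b, E31 b⁆ = 0 ∧ ⁅E31 b, E32 b⁆ = 0 ∧ ⁅E31 b, H10 b⁆ = (-3 : ℂ) • E31 b ∧
    ⁅E31 b, H01 b⁆ = E31 b ∧ ⁅E31 b, F10 b⁆ = E21 b ∧ ⁅E31 b, F01 b⁆ = 0 ∧ ⁅E31 b, F11 b⁆ = 0 ∧
    ⁅E31 b, F21 b⁆ = -E10 b ∧ ⁅E31 b, F31 b⁆ = H10 b + H01 b ∧ ⁅E31 b, F32 b⁆ = -F01 b := by
  have h (w : 𝔤) : ⁅E31 b, w⁆ = (1 / 3 : ℂ) • (⁅E21 b, ⁅E10 b, w⁆⁆ - ⁅E10 b, ⁅E21 b, w⁆⁆) := by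
    rw [E31, smul_lie, lie_lie]
  simp only [h, lie_E21 b, lie_E10 b, lie_smul, lie_neg, lie_add, lie_sub, lie_zero]
  refine ⟨?_, ?_, ?_, ?_, ?_, ?_, ?_, ?_, ?_, ?_, ?_, ?_, ?_, ?_⟩ <;> module

theorem lie_E32 :
    ⁅E32 b, E10 b⁆ = 0 ∧ ⁅E32 b, E01 b⁆ = 0 ∧ ⁅E32 b, E11 b⁆ = 0 ∧ ⁅E32 b, E21 b⁆ = 0 ∧
    ⁅E32 b, E31 b⁆ = 0 ∧ ⁅E32 b, E32 b⁆ = 0 ∧ ⁅E32 b, H10 b⁆ = 0 ∧ ⁅E32 b, H01 b⁆ = -E32 b ∧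
    ⁅E32 b, F10 b⁆ = 0 ∧ ⁅E32 b, F01 b⁆ = E31 b ∧ ⁅E32 b, F11 b⁆ = E21 b ∧
    ⁅E32 b, F21 b⁆ = -E11 b ∧ ⁅E32 b, F31 b⁆ = -E01 b ∧ ⁅E32 b, F32 b⁆ = H10 b + (2 : ℂ) • H01 b := by
  have h (w : 𝔤) : ⁅E32 b, w⁆ = ⁅E31 b, ⁅E01 b, w⁆⁆ - ⁅E01 b, ⁅E31 b, w⁆⁆ := by
    rw [E32, lie_lie]
  simp only [h, lie_E31 b, lie_E01 b, lie_smul, lie_neg, lie_add, lie_sub, lie_zero]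
  refine ⟨?_, ?_, ?_, ?_, ?_, ?_, ?_, ?_, ?_, ?_, ?_, ?_, ?_, ?_⟩ <;> module

theorem lie_F11 :
    ⁅F11 b, E10 b⁆ = (3 : ℂ) • F01 b ∧ ⁅F11 b, E01 b⁆ = -F10 b ∧
    ⁅F11 b, E11 b⁆ = -H10 b - (3 : ℂ) • H01 b ∧ ⁅F11 b, E21 b⁆ = (2 : ℂ) • E10 b ∧
    ⁅F11 b, E31 b⁆ = 0 ∧ ⁅F11 b, E32 b⁆ = -E21 b ∧ ⁅F11 b, H10 b⁆ = -F11 b ∧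
    ⁅F11 b, H01 b⁆ = F11 b ∧ ⁅F11 b, F10 b⁆ = (-2 : ℂ) • F21 b ∧ ⁅F11 b, F01 b⁆ = 0 ∧
    ⁅F11 b, F11 b⁆ = 0 ∧ ⁅F11 b, F21 b⁆ = (3 : ℂ) • F32 b ∧ ⁅F11 b, F31 b⁆ = 0 ∧
    ⁅F11 b, F32 b⁆ = 0 := by
  have h (w : 𝔤) : ⁅F11 b, w⁆ = ⁅F01 b, ⁅F10 b, w⁆⁆ - ⁅F10 b, ⁅F01 b, w⁆⁆ := by
    rw [F11, lie_lie]
  simp only [h, lie_F01 b, lie_F10 b, lie_smul, lie_neg, lie_add, lie_sub, lie_zero]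
  refine ⟨?_, ?_, ?_, ?_, ?_, ?_, ?_, ?_, ?_, ?_, ?_, ?_, ?_, ?_⟩ <;> module

theorem lie_F21 :
    ⁅F21 b, E10 b⁆ = (-2 : ℂ) • F11 b ∧ ⁅F21 b, E01 b⁆ = 0 ∧ ⁅F21 b, E11 b⁆ = (2 : ℂ) • F10 b ∧
    ⁅F21 b, E21 b⁆ = (-2 : ℂ) • H10 b - (3 : ℂ) • H01 b ∧ ⁅F21 b, E31 b⁆ = E10 b ∧
    ⁅F21 b, E32 b⁆ = E11 b ∧ ⁅F21 b, H10 b⁆ = F21 b ∧ ⁅F21 b, H01 b⁆ = 0 ∧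
    ⁅F21 b, F10 b⁆ = (-3 : ℂ) • F31 b ∧ ⁅F21 b, F01 b⁆ = 0 ∧ ⁅F21 b, F11 b⁆ = (-3 : ℂ) • F32 b ∧
    ⁅F21 b, F21 b⁆ = 0 ∧ ⁅F21 b, F31 b⁆ = 0 ∧ ⁅F21 b, F32 b⁆ = 0 := by
  have h (w : 𝔤) : ⁅F21 b, w⁆ = (1 / 2 : ℂ) • (⁅F10 b, ⁅F11 b, w⁆⁆ - ⁅F11 b, ⁅F10 b, w⁆⁆) := by
    rw [F21, smul_lie, lie_lie]
  simp only [h, lie_F10 b, lie_F11 b, lie_smul, lie_neg, lie_add, lie_sub, lie_zero]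
  refine ⟨?_, ?_, ?_, ?_, ?_, ?_, ?_, ?_, ?_, ?_, ?_, ?_, ?_, ?_⟩ <;> module

theorem lie_F31 :
    ⁅F31 b, E10 b⁆ = -F21 b ∧ ⁅F31 b, E01 b⁆ = 0 ∧ ⁅F31 b, E11 b⁆ = 0 ∧ ⁅F31 b, E21 b⁆ = F10 b ∧
    ⁅F31 b, E31 b⁆ = -H10 b - H01 b ∧ ⁅F31 b, E32 b⁆ = E01 b ∧ ⁅F31 b, H10 b⁆ = (3 : ℂ) • F31 b ∧
    ⁅F31 b, H01 b⁆ = -F31 b ∧ ⁅F31 b, F10 b⁆ = 0 ∧ ⁅F31 b, F01 b⁆ = -F32 b ∧ ⁅F31 b, F11 b⁆ = 0 ∧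
    ⁅F31 b, F21 b⁆ = 0 ∧ ⁅F31 b, F31 b⁆ = 0 ∧ ⁅F31 b, F32 b⁆ = 0 := by
  have h (w : 𝔤) : ⁅F31 b, w⁆ = (1 / 3 : ℂ) • (⁅F10 b, ⁅F21 b, w⁆⁆ - ⁅F21 b, ⁅F10 b, w⁆⁆) := by
    rw [F31, smul_lie, lie_lie]
  simp only [h, lie_F10 b, lie_F21 b, lie_smul, lie_neg, lie_add, lie_sub, lie_zero]
  refine ⟨?_, ?_, ?_, ?_, ?_, ?_, ?_, ?_, ?_, ?_, ?_, ?_, ?_, ?_⟩ <;> module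

theorem lie_F32 :
    ⁅F32 b, E10 b⁆ = 0 ∧ ⁅F32 b, E01 b⁆ = -F31 b ∧ ⁅F32 b, E11 b⁆ = -F21 b ∧
    ⁅F32 b, E21 b⁆ = F11 b ∧ ⁅F32 b, E31 b⁆ = F01 b ∧ ⁅F32 b, E32 b⁆ = -H10 b - (2 : ℂ) • H01 b ∧
    ⁅F32 b, H10 b⁆ = 0 ∧ ⁅F32 b, H01 b⁆ = F32 b ∧ ⁅F32 b, F10 b⁆ = 0 ∧ ⁅F32 b, F01 b⁆ = 0 ∧
    ⁅F32 b, F11 b⁆ = 0 ∧ ⁅F32 b, F21 b⁆ = 0 ∧ ⁅F32 b, F31 b⁆ = 0 ∧ ⁅F32 b, F32 b⁆ = 0 := by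
  have h (w : 𝔤) : ⁅F32 b, w⁆ = ⁅F01 b, ⁅F31 b, w⁆⁆ - ⁅F31 b, ⁅F01 b, w⁆⁆ := by
    rw [F32, lie_lie]
  simp only [h, lie_F01 b, lie_F31 b, lie_smul, lie_neg, lie_add, lie_sub, lie_zero]
  refine ⟨?_, ?_, ?_, ?_, ?_, ?_, ?_, ?_, ?_, ?_, ?_, ?_, ?_, ?_⟩ <;> module

end MultiplicationTable

end RootSystem

/-! ### Invariant bilinear forms, and spanning by the root vectors. -/

section InvariantForm

variable {𝔤 : Type*} [LieRing 𝔤] [LieAlgebra ℂ 𝔤] {𝔥 : LieSubalgebra ℂ 𝔤}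
  (b : LieAlgebra.Basis (Fin 2) 𝔥)

theorem F01_ne_zero : F01 b ≠ 0 := (b.sl2 1).f_ne_zero

theorem invariant_eq_zero_of_weight {Φ : LinearMap.BilinForm ℂ 𝔤} (hΦ : Φ.lieInvariant 𝔤)
    {h x y : 𝔤} {p q : ℂ} (hx : ⁅h, x⁆ = p • x) (hy : ⁅h, y⁆ = q • y) (hpq : p + q ≠ 0) :
    Φ x y = 0 := by
  have key := hΦ h x y
  rw [hx, hy, map_smul, map_smul, LinearMap.smul_apply, smul_eq_mul, smul_eq_mul] at key
  have : (p + q) * Φ x y = 0 := by linear_combination key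
  exact (mul_eq_zero.mp this).resolve_left hpq

variable [IsTypeG2 b]

/-- An invariant form pairs only opposite weights. `F32` has weight `(0, -1)` under `(H10, H01)`,
and of the fourteen vectors only `E32` has weight `(0, 1)`. Most cases are separated by `H10`; the
coroots and `F32` itself need `H01`. -/
theorem invariant_F32 {Φ : LinearMap.BilinForm ℂ 𝔤} (hΦ : Φ.lieInvariant 𝔤) :
    Φ (F32 b) (E10 b) = 0 ∧ Φ (F32 b) (E01 b) = 0 ∧ Φ (F32 b) (E11 b) = 0 ∧
    Φ (F32 b) (E21 b) = 0 ∧ Φ (F32 b) (E31 b) = 0 ∧ Φ (F32 b) (H10 b) = 0 ∧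
    Φ (F32 b) (H01 b) = 0 ∧ Φ (F32 b) (F10 b) = 0 ∧ Φ (F32 b) (F01 b) = 0 ∧
    Φ (F32 b) (F11 b) = 0 ∧ Φ (F32 b) (F21 b) = 0 ∧ Φ (F32 b) (F31 b) = 0 ∧
    Φ (F32 b) (F32 b) = 0 := by
  have w0 {y : 𝔤} (q : ℂ) (hy : ⁅H10 b, y⁆ = q • y) (hq : q ≠ 0) : Φ (F32 b) y = 0 :=
    invariant_eq_zero_of_weight hΦ (h := H10 b) (p := 0) (by simp only [lie_H10 b, zero_smul]) hy
      (by rwa [zero_add])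
  have w1 {y : 𝔤} (q : ℂ) (hy : ⁅H01 b, y⁆ = q • y) (hq : -1 + q ≠ 0) : Φ (F32 b) y = 0 :=
    invariant_eq_zero_of_weight hΦ (h := H01 b) (p := -1)
      (by simp only [lie_H01 b, neg_smul, one_smul]) hy hq
  refine ⟨w0 2 ?_ ?_, w0 (-3) ?_ ?_, w0 (-1) ?_ ?_, w0 1 ?_ ?_, w0 3 ?_ ?_, w1 0 ?_ ?_,
    w1 0 ?_ ?_, w0 (-2) ?_ ?_, w0 3 ?_ ?_, w0 1 ?_ ?_, w0 (-1) ?_ ?_, w0 (-3) ?_ ?_,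
    w1 (-1) ?_ ?_⟩
  all_goals first
    | (simp only [lie_H10 b, lie_H01 b]; done)
    | (simp only [lie_H10 b, lie_H01 b]; module)
    | norm_num

variable [FiniteDimensional ℂ 𝔤]

/-- The root vectors and the coroots of the simple roots. -/
def rootVectors : Set 𝔤 :=
  {E10 b, E01 b, E11 b, E21 b, E31 b, E32 b, H10 b, H01 b, F10 b, F01 b, F11 b, F21 b, F31 b, F32 b}

theorem lie_mem_span_rootVectors {x y : 𝔤} (hx : x ∈ Set.range b.e ∪ Set.range b.f)
    (hy : y ∈ Submodule.span ℂ (rootVectors b)) :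
    ⁅x, y⁆ ∈ Submodule.span ℂ (rootVectors b) := by
  have hS : ∀ z ∈ rootVectors b, z ∈ Submodule.span ℂ (rootVectors b) :=
    fun z hz => Submodule.subset_span hz
  induction hy using Submodule.span_induction with
  | mem y hy =>
    set S := Submodule.span ℂ (rootVectors b)
    simp only [rootVectors, Set.mem_insert_iff, Set.mem_singleton_iff, forall_eq_or_imp,
      forall_eq] at hS hy
    have hx' : x = E10 b ∨ x = E01 b ∨ x = F10 b ∨ x = F01 b := by
      rcases hx with ⟨i, rfl⟩ | ⟨i, rfl⟩ <;> fin_cases i <;> simp [E10, E01, F10, F01]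
    rcases hx' with rfl | rfl | rfl | rfl <;>
    rcases hy with rfl | rfl | rfl | rfl | rfl | rfl | rfl | rfl | rfl | rfl | rfl | rfl | rfl | rfl <;>
    simp [lie_E10 b, lie_E01 b, lie_F10 b, lie_F01 b, hS]
  | zero => rw [lie_zero]; exact zero_mem _
  | add y z _ _ hy hz => rw [lie_add]; exact add_mem hy hz
  | smul c y _ hy => rw [lie_smul]; exact Submodule.smul_mem _ c hy

/-- The root vectors and the coroots of the simple roots span the Lie algebra. -/
theorem span_rootVectors : Submodule.span ℂ (rootVectors b) = ⊤ := by
  set S := Submodule.span ℂ (rootVectors b)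
  have hef : Set.range b.e ∪ Set.range b.f ⊆ rootVectors b := by
    rintro - (⟨i, rfl⟩ | ⟨i, rfl⟩) <;> fin_cases i <;> simp [rootVectors, E10, E01, F10, F01]
  -- The elements whose adjoint action preserves `S` form a subalgebra, and it contains the
  -- generators.
  have hlie (x : 𝔤) : ∀ y ∈ S, ⁅x, y⁆ ∈ S := by
    have hx : x ∈ LieSubalgebra.lieSpan ℂ 𝔤 (Set.range b.e ∪ Set.range b.f) := by
      rw [b.span_ef]; trivial
    induction hx using LieSubalgebra.lieSpan_induction with
    | mem x hx => exact fun y hy => lie_mem_span_rootVectors b hx hy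
    | zero => intro y _; rw [zero_lie]; exact zero_mem _
    | add x x' _ _ hx hx' => intro y hy; rw [add_lie]; exact add_mem (hx y hy) (hx' y hy)
    | smul c x _ hx => intro y hy; rw [smul_lie]; exact Submodule.smul_mem _ c (hx y hy)
    | lie x x' _ _ hx hx' =>
      intro y hy
      rw [lie_lie]
      exact sub_mem (hx _ (hx' y hy)) (hx' _ (hx y hy))
  let S' : LieSubalgebra ℂ 𝔤 := { S with lie_mem' := fun {x y} _ hy => hlie x y hy }
  have h : LieSubalgebra.lieSpan ℂ 𝔤 (Set.range b.e ∪ Set.range b.f) ≤ S' :=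
    LieSubalgebra.lieSpan_le.mpr fun x hx => Submodule.subset_span (hef hx)
  rw [b.span_ef] at h
  exact eq_top_iff.mpr fun x _ => h (LieSubalgebra.mem_top x)

theorem F32_ne_zero : F32 b ≠ 0 := by
  intro h
  have h' : ⁅F32 b, E31 b⁆ = F01 b := by simp only [lie_F32 b]
  rw [h, zero_lie] at h'
  exact F01_ne_zero b h'.symm

theorem E31_ne_zero : E31 b ≠ 0 := by
  intro h
  have h' : ⁅F32 b, E31 b⁆ = F01 b := by simp only [lie_F32 b]
  rw [h, lie_zero] at h'
  exact F01_ne_zero b h'.symm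

theorem H32_eq : H32 b = H10 b + (2 : ℂ) • H01 b := by simp only [H32, lie_E32 b]

/-! ### The invariant form -/

theorem invariant_H32_H32 {Φ : LinearMap.BilinForm ℂ 𝔤} (hΦ : Φ.lieInvariant 𝔤) :
    Φ (H32 b) (H32 b) = 2 * Φ (F32 b) (E32 b) := by
  have h : ⁅E32 b, H32 b⁆ = (-2 : ℂ) • E32 b := by
    simp only [H32_eq, lie_add, lie_smul, lie_E32 b]; module
  conv_lhs => rw [H32, hΦ, ← H32, h, map_smul, smul_eq_mul]
  ring

/-- This makes the division in the normalization legitimate. If the value were zero, `F32` would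
also be orthogonal to `E32`, hence to everything, against nondegeneracy of the Killing form. -/
theorem killingForm_H32_H32_ne_zero [LieAlgebra.IsSimple ℂ 𝔤] :
    killingForm ℂ 𝔤 (H32 b) (H32 b) ≠ 0 := by
  have hinv : (killingForm ℂ 𝔤).lieInvariant 𝔤 := LieModule.traceForm_lieInvariant ℂ 𝔤 𝔤
  rw [invariant_H32_H32 b hinv]
  intro h0
  have h32 : killingForm ℂ 𝔤 (F32 b) (E32 b) = 0 := by simpa using h0
  refine F32_ne_zero b ?_
  have hker : F32 b ∈ LinearMap.ker (killingForm ℂ 𝔤) := by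
    rw [LinearMap.mem_ker]
    refine LinearMap.ext_on (span_rootVectors b) fun y hy => ?_
    simp only [rootVectors, Set.mem_insert_iff, Set.mem_singleton_iff] at hy
    rcases hy with rfl | rfl | rfl | rfl | rfl | rfl | rfl | rfl | rfl | rfl | rfl | rfl | rfl | rfl <;>
    simp only [invariant_F32 b hinv, h32, LinearMap.zero_apply]
  rwa [LieAlgebra.IsKilling.ker_killingForm_eq_bot, Submodule.mem_bot] at hker

/-- The values of the normalized form which occur in commutators of `F₃₂(1)` and `x(-1)`. -/
theorem normalizedKillingForm_F32 [LieAlgebra.IsSimple ℂ 𝔤] :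
    normalizedKillingForm 𝔤 (H32 b) (F32 b) (E10 b) = 0 ∧
    normalizedKillingForm 𝔤 (H32 b) (F32 b) (E01 b) = 0 ∧
    normalizedKillingForm 𝔤 (H32 b) (F32 b) (E11 b) = 0 ∧
    normalizedKillingForm 𝔤 (H32 b) (F32 b) (E21 b) = 0 ∧
    normalizedKillingForm 𝔤 (H32 b) (F32 b) (E31 b) = 0 ∧
    normalizedKillingForm 𝔤 (H32 b) (F32 b) (E32 b) = 1 ∧
    normalizedKillingForm 𝔤 (H32 b) (F32 b) (H01 b) = 0 ∧
    normalizedKillingForm 𝔤 (H32 b) (F32 b) (F01 b) = 0 := by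
  have hinv := normalizedKillingForm_lieInvariant 𝔤 (H32 b)
  have h32 : normalizedKillingForm 𝔤 (H32 b) (F32 b) (E32 b) = 1 := by
    have h := invariant_H32_H32 b hinv
    rw [normalizedKillingForm_apply, div_mul_cancel₀ _ (killingForm_H32_H32_ne_zero b)] at h
    linear_combination (-1 / 2) * h
  have h := invariant_F32 b hinv
  simp only [h, h32, and_self]

end InvariantForm

/-! ### Modules over a Lie algebra with a decomposition into two subspaces -/

section Factorization

attribute [local instance 100] LieRing.ofAssociativeRing

variable {R L : Type*} [CommRing R] [LieRing L] [LieAlgebra R L]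

/-- By the universal property the identity factors through the subalgebra generated by the image of
`L`. -/
theorem adjoin_range_ι : Algebra.adjoin R
    (Set.range (UniversalEnvelopingAlgebra.ι R : L → UniversalEnvelopingAlgebra R L)) = ⊤ := by
  set A := Algebra.adjoin R
    (Set.range (UniversalEnvelopingAlgebra.ι R : L → UniversalEnvelopingAlgebra R L))
  let f : L →ₗ⁅R⁆ A :=
    { toFun x := ⟨UniversalEnvelopingAlgebra.ι R x, Algebra.subset_adjoin ⟨x, rfl⟩⟩
      map_add' x y := Subtype.ext (map_add _ x y)
      map_smul' c x := Subtype.ext (map_smul _ c x)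
      map_lie' {x y} := Subtype.ext (LieHom.map_lie _ x y) }
  have h : A.val.comp (UniversalEnvelopingAlgebra.lift R f) = AlgHom.id R _ := by
    ext x
    simp [f]
  exact eq_top_iff.mpr fun x _ => by
    rw [← AlgHom.id_apply (R := R) x, ← h]
    exact (UniversalEnvelopingAlgebra.lift R f x).2

/-- Induction on elements of the universal enveloping algebra by left multiplication. -/
theorem envelopingAlgebra_induction {p : UniversalEnvelopingAlgebra R L → Prop}
    (one : p 1) (add : ∀ a c, p a → p c → p (a + c)) (smul : ∀ (r : R) a, p a → p (r • a))
    (ι_mul : ∀ x a, p a → p (UniversalEnvelopingAlgebra.ι R x * a))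
    (a : UniversalEnvelopingAlgebra R L) : p a := by
  -- The predicate need not be multiplicative, so the induction is on the claim that left
  -- multiplication by `a` preserves it.
  have key : ∀ c, p c → p (a * c) := by
    have ha : a ∈ Algebra.adjoin R
        (Set.range (UniversalEnvelopingAlgebra.ι R : L → UniversalEnvelopingAlgebra R L)) := by
      rw [adjoin_range_ι]; trivial
    induction ha using Algebra.adjoin_induction with
    | mem x hx => obtain ⟨x, rfl⟩ := hx; exact ι_mul x
    | algebraMap r => intro c hc; rw [← Algebra.smul_def]; exact smul r c hc
    | add x y _ _ hx hy => intro c hc; rw [add_mul]; exact add _ _ (hx c hc) (hy c hc)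
    | mul x y _ _ hx hy => intro c hc; rw [mul_assoc]; exact hx _ (hy c hc)
  simpa using key 1 one

variable {Q : LieSubalgebra R L}

/-- The action of `Q` on the space of linear maps from `L` to the enveloping algebra of `Q`. -/
def homAction (Q : LieSubalgebra R L) :
    Q →ₗ⁅R⁆ Module.End R (L →ₗ[R] UniversalEnvelopingAlgebra R Q) where
  toFun q :=
    { toFun g := LinearMap.mulLeft R (UniversalEnvelopingAlgebra.ι R q) ∘ₗ g -
        g ∘ₗ (LieAlgebra.ad R L q : L →ₗ[R] L)
      map_add' g g' := by ext x; simp [mul_add]; abel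
      map_smul' r g := by ext x; simp [smul_sub] }
  map_add' q q' := by ext g x; simp [add_mul]; abel
  map_smul' r q := by ext g x; simp [smul_sub]
  map_lie' {q q'} := by
    ext g x
    simp [LieRing.of_associative_ring_bracket, mul_assoc, mul_sub, sub_mul]
    abel

theorem homAction_apply (q : Q) (g : L →ₗ[R] UniversalEnvelopingAlgebra R Q) (x : L) :
    homAction Q q g x = UniversalEnvelopingAlgebra.ι R q * g x - g ⁅(q : L), x⁆ := rfl

/-- The operator by which `x : L` acts on the enveloping algebra of the subalgebra `Q`, if it acts
on `1` by `f x`. -/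
def extendedAction (f : L →ₗ[R] UniversalEnvelopingAlgebra R Q) :
    L →ₗ[R] Module.End R (UniversalEnvelopingAlgebra R Q) :=
  ((LinearMap.applyₗ f) ∘ₗ
    (UniversalEnvelopingAlgebra.lift R (homAction Q)).toLinearMap).flip

variable {f : L →ₗ[R] UniversalEnvelopingAlgebra R Q}

theorem extendedAction_one (x : L) : extendedAction f x 1 = f x := by
  simp [extendedAction]

/-- This is the recursion that any action extending left multiplication by `Q` must satisfy. With
the value `f x` at `1` it determines the operators, and `homAction` is designed to encode it: that
being a representation of `Q`, it extends to the enveloping algebra. -/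
theorem extendedAction_ι_mul (x : L) (q : Q) (m : UniversalEnvelopingAlgebra R Q) :
    extendedAction f x (UniversalEnvelopingAlgebra.ι R q * m) =
      UniversalEnvelopingAlgebra.ι R q * extendedAction f x m +
        extendedAction f ⁅x, (q : L)⁆ m := by
  have h (y : L) (a : UniversalEnvelopingAlgebra R Q) : extendedAction f y a =
    UniversalEnvelopingAlgebra.lift R (homAction Q) a f y := rfl
  rw [h, map_mul, UniversalEnvelopingAlgebra.lift_ι_apply, Module.End.mul_apply, homAction_apply,
    ← lie_skew x, map_neg, LinearMap.neg_apply, h, h, sub_eq_add_neg]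

theorem extendedAction_of_mem (hf : ∀ q : Q, f q = UniversalEnvelopingAlgebra.ι R q) (q : Q)
    (m : UniversalEnvelopingAlgebra R Q) :
    extendedAction f q m = UniversalEnvelopingAlgebra.ι R q * m := by
  induction m using envelopingAlgebra_induction generalizing q with
  | one => rw [extendedAction_one, hf, mul_one]
  | add a c ha hc => rw [map_add, ha, hc, mul_add]
  | smul r a ha => rw [map_smul, ha, mul_smul_comm]
  | ι_mul x a ha =>
    rw [extendedAction_ι_mul, ha, ← LieSubalgebra.coe_bracket, ha, LieHom.map_lie,
      LieRing.of_associative_ring_bracket]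
    noncomm_ring

/-- If `L = Q + P`, then `L` acts on the enveloping algebra of `Q` in such a way that `Q` acts by
left multiplication and `P` acts on `1` by the given character. -/
theorem extendedAction_lie (hf : ∀ q : Q, f q = UniversalEnvelopingAlgebra.ι R q)
    {P : Submodule R L} (hPQ : P ⊔ Q.toSubmodule = ⊤) {χ : L →ₗ[R] R}
    (hfP : ∀ p ∈ P, f p = algebraMap R _ (χ p)) (hP : ∀ p ∈ P, ∀ p' ∈ P, f ⁅p, p'⁆ = 0) (x y : L)
    (m : UniversalEnvelopingAlgebra R Q) :
    extendedAction f ⁅x, y⁆ m =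
      extendedAction f x (extendedAction f y m) - extendedAction f y (extendedAction f x m) := by
  induction m using envelopingAlgebra_induction generalizing x y with
  | one =>
    -- At `1` both sides are bilinear in `x` and `y`, so it suffices to take each in `P` or in `Q`.
    have hx : x ∈ P ⊔ Q.toSubmodule := hPQ ▸ Submodule.mem_top
    have hy : y ∈ P ⊔ Q.toSubmodule := hPQ ▸ Submodule.mem_top
    obtain ⟨p, hp, q, hq, rfl⟩ := Submodule.mem_sup.mp hx
    obtain ⟨p', hp', q', hq', rfl⟩ := Submodule.mem_sup.mp hy
    have act_q (a : L) (ha : a ∈ Q.toSubmodule) (m : UniversalEnvelopingAlgebra R Q) :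
      extendedAction f a m = UniversalEnvelopingAlgebra.ι R ⟨a, ha⟩ * m :=
        extendedAction_of_mem hf ⟨a, ha⟩ m
    have act_P (a c : L) (ha : a ∈ P) (hc : c ∈ Q.toSubmodule) :
        extendedAction f ⁅a, c⁆ 1 =
          extendedAction f a (extendedAction f c 1) - extendedAction f c (extendedAction f a 1) := by
      rw [act_q c hc, act_q c hc, extendedAction_ι_mul, add_sub_cancel_left]
    have act_PP : extendedAction f ⁅p, p'⁆ 1 =
        extendedAction f p (extendedAction f p' 1) - extendedAction f p' (extendedAction f p 1) := by
      simp only [extendedAction_one, hfP p hp, hfP p' hp', hP p hp p' hp', Algebra.algebraMap_eq_smul_one,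
        map_smul]
      rw [smul_comm, sub_self]
    have act_QQ : extendedAction f ⁅q, q'⁆ 1 =
        extendedAction f q (extendedAction f q' 1) - extendedAction f q' (extendedAction f q 1) := by
      rw [act_q q hq, act_q q' hq', act_q q hq, act_q q' hq',
        act_q ⁅q, q'⁆ (Q.lie_mem hq hq')]
      simp only [mul_one]
      exact LieHom.map_lie (UniversalEnvelopingAlgebra.ι R) (⟨q, hq⟩ : Q) ⟨q', hq'⟩
    have act_QP : extendedAction f ⁅q, p'⁆ 1 =
        extendedAction f q (extendedAction f p' 1) - extendedAction f p' (extendedAction f q 1) := by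
      rw [← lie_skew, map_neg, LinearMap.neg_apply, act_P p' q hp' hq, neg_sub]
    simp only [add_lie, lie_add, map_add, LinearMap.add_apply, act_PP, act_QQ, act_QP,
      act_P p q' hp hq']
    abel
  | add a c ha hc => simp only [map_add, ha, hc]; abel
  | smul r a ha => simp only [map_smul, ha, smul_sub]
  | ι_mul q a ha =>
    -- Moving `q` to the left creates brackets with `q`. The induction hypothesis is therefore
    -- needed for `(x, [y, q])` and `(y, [x, q])` as well as for `(x, y)`.
    have jac : ⁅⁅x, y⁆, (q : L)⁆ = ⁅x, ⁅y, (q : L)⁆⁆ - ⁅y, ⁅x, (q : L)⁆⁆ := lie_lie ..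
    rw [extendedAction_ι_mul, ha x y, jac]
    simp only [extendedAction_ι_mul, map_add, map_sub, LinearMap.sub_apply, ha x, ha y]
    noncomm_ring

end Factorization

/-! ### Coordinates on the affine Lie algebra -/

section Coordinates

variable {𝔤 : Type*} [LieRing 𝔤] [LieAlgebra ℂ 𝔤] {t : 𝔤}

/-- The map `x ↦ x(n)` as a linear map. -/
def modeLinear (t : 𝔤) (n : ℤ) : 𝔤 →ₗ[ℂ] AffineLieAlgebra 𝔤 t where
  toFun x := mode x n
  map_add' x y := by
    refine congrArg (LieAlgebra.ofProd (affineCocycle 𝔤 t)) (Prod.ext ?_ ?_)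
    · exact TensorProduct.tmul_add _ _ _
    · exact (add_zero _).symm
  map_smul' c x := by
    refine congrArg (LieAlgebra.ofProd (affineCocycle 𝔤 t)) (Prod.ext ?_ ?_)
    · exact TensorProduct.tmul_smul _ _ _
    · exact (smul_zero _).symm

/-- The Laurent polynomial part of an element of the affine Lie algebra. -/
def loopPart (t : 𝔤) : AffineLieAlgebra 𝔤 t →ₗ[ℂ] ℤ →₀ 𝔤 where
  toFun y := LieAlgebra.LoopAlgebra.toFinsupp ℂ ℤ 𝔤
    ((LieAlgebra.ofProd (affineCocycle 𝔤 t)).symm y).1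
  map_add' _ _ := map_add (LieAlgebra.LoopAlgebra.toFinsupp ℂ ℤ 𝔤) _ _
  map_smul' c _ := map_smul (LieAlgebra.LoopAlgebra.toFinsupp ℂ ℤ 𝔤) c _

/-- The coefficient of `K` in an element of the affine Lie algebra. -/
def centralPart (t : 𝔤) : AffineLieAlgebra 𝔤 t →ₗ[ℂ] ℂ where
  toFun y := TrivialLieModule.equiv ℂ _ ℂ ((LieAlgebra.ofProd (affineCocycle 𝔤 t)).symm y).2
  map_add' _ _ := rfl
  map_smul' _ _ := rfl

theorem loopPart_mode (x : 𝔤) (n : ℤ) : loopPart t (mode x n) = Finsupp.single n x :=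
  LieAlgebra.LoopAlgebra.toFinsupp_single_tmul ℂ ℤ 𝔤 n x

theorem loopPart_central : loopPart t (central 𝔤 t) = 0 :=
  map_zero (LieAlgebra.LoopAlgebra.toFinsupp ℂ ℤ 𝔤)

theorem centralPart_mode (x : 𝔤) (n : ℤ) : centralPart t (mode x n) = 0 := rfl

theorem centralPart_central : centralPart t (central 𝔤 t) = 1 := rfl

theorem ext_loopPart_centralPart {y z : AffineLieAlgebra 𝔤 t} (h : loopPart t y = loopPart t z)
    (h' : centralPart t y = centralPart t z) : y = z :=
  (LieAlgebra.ofProd (affineCocycle 𝔤 t)).symm.injective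
    (Prod.ext ((LieAlgebra.LoopAlgebra.toFinsupp ℂ ℤ 𝔤).injective h)
      ((TrivialLieModule.equiv ℂ _ ℂ).injective h'))

theorem eq_sum_mode_add_central (y : AffineLieAlgebra 𝔤 t) :
    y = (loopPart t y).sum (fun n x => mode x n) + centralPart t y • central 𝔤 t := by
  apply ext_loopPart_centralPart
  · simp only [map_add, map_smul, map_finsuppSum, loopPart_mode, loopPart_central, smul_zero,
      add_zero, Finsupp.sum_single]
  · simp only [map_add, map_smul, Finsupp.sum, map_sum, centralPart_mode, centralPart_central,
      Finset.sum_const_zero, zero_add, smul_eq_mul, mul_one]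

variable (𝔤 t) in
/-- The subalgebra `𝔤 ⊗ t⁻¹ ℂ[t⁻¹]` of the affine Lie algebra. -/
def negativePart : LieSubalgebra ℂ (AffineLieAlgebra 𝔤 t) where
  __ := Submodule.span ℂ {y | ∃ (x : 𝔤) (n : ℤ), n < 0 ∧ y = mode x n}
  lie_mem' {y z} hy hz := by
    change y ∈ Submodule.span ℂ _ at hy
    change z ∈ Submodule.span ℂ _ at hz
    change ⁅y, z⁆ ∈ Submodule.span ℂ _
    induction hy, hz using Submodule.span_induction₂ with
    | mem_mem y z hy hz =>
      obtain ⟨x, m, hm, rfl⟩ := hy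
      obtain ⟨x', n, hn, rfl⟩ := hz
      -- Two negative indices never add up to zero, so no central term arises.
      rw [lie_mode_mode, if_neg (by omega), zero_smul, add_zero]
      exact Submodule.subset_span ⟨_, _, by omega, rfl⟩
    | zero_left y _ => rw [zero_lie]; exact zero_mem _
    | zero_right y _ => rw [lie_zero]; exact zero_mem _
    | add_left x y z _ _ _ hx hy => rw [add_lie]; exact add_mem hx hy
    | add_right x y z _ _ _ hx hy => rw [lie_add]; exact add_mem hx hy
    | smul_left r x y _ _ h => rw [smul_lie]; exact Submodule.smul_mem _ r h
    | smul_right r x y _ _ h => rw [lie_smul]; exact Submodule.smul_mem _ r h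

theorem mode_mem_negativePart (x : 𝔤) {n : ℤ} (hn : n < 0) : mode x n ∈ negativePart 𝔤 t :=
  Submodule.subset_span (s := {y | ∃ (x : 𝔤) (n : ℤ), n < 0 ∧ y = mode x n}) ⟨x, n, hn, rfl⟩

variable (𝔤 t) in
/-- The subspace `𝔤[t] ⊕ ℂ K` of the affine Lie algebra. -/
def nonnegativePart : Submodule ℂ (AffineLieAlgebra 𝔤 t) :=
  Submodule.span ℂ ({y | ∃ (x : 𝔤) (n : ℤ), 0 ≤ n ∧ y = mode x n} ∪ {central 𝔤 t})

theorem nonnegativePart_sup_negativePart :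
    nonnegativePart 𝔤 t ⊔ (negativePart 𝔤 t).toSubmodule = ⊤ := by
  refine eq_top_iff.mpr fun y _ => ?_
  rw [eq_sum_mode_add_central y]
  refine add_mem (Submodule.sum_mem _ fun n _ => ?_) (Submodule.smul_mem _ _ ?_)
  · rcases lt_or_ge n 0 with hn | hn
    · exact Submodule.mem_sup_right (mode_mem_negativePart _ hn)
    · exact Submodule.mem_sup_left (Submodule.subset_span (Or.inl ⟨_, n, hn, rfl⟩))
  · exact Submodule.mem_sup_left (Submodule.subset_span (Or.inr rfl))

end Coordinates

/-! ### Linear functionals on the enveloping algebra which vanish on the annihilator of `𝟏` -/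

section Functional

attribute [local instance 100] LieRing.ofAssociativeRing

variable {𝔤 : Type*} [LieRing 𝔤] [LieAlgebra ℂ 𝔤] {t : 𝔤}

/-- The map by which the affine Lie algebra acts on `1` in the realization of `N(k, 0)` on the
enveloping algebra of `𝔤 ⊗ t⁻¹ ℂ[t⁻¹]`. -/
def actionOnOne (t : 𝔤) (k : ℂ) :
    AffineLieAlgebra 𝔤 t →ₗ[ℂ] UniversalEnvelopingAlgebra ℂ (negativePart 𝔤 t) :=
  Finsupp.lsum ℂ (fun n : ℤ => if hn : n < 0 then
      (UniversalEnvelopingAlgebra.ι ℂ : negativePart 𝔤 t →ₗ⁅ℂ⁆ _).toLinearMap ∘ₗ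
        (modeLinear t n).codRestrict (negativePart 𝔤 t).toSubmodule
          (fun x => mode_mem_negativePart x hn) else 0) ∘ₗ loopPart t +
    k • (Algebra.linearMap ℂ _ ∘ₗ centralPart t)

variable {k : ℂ}

theorem actionOnOne_mode_of_neg (x : 𝔤) {n : ℤ} (hn : n < 0) :
    actionOnOne t k (mode x n) =
      UniversalEnvelopingAlgebra.ι ℂ ⟨mode x n, mode_mem_negativePart x hn⟩ := by
  simp only [actionOnOne, LinearMap.add_apply, LinearMap.comp_apply, loopPart_mode,
    LinearMap.smul_apply, centralPart_mode, map_zero, smul_zero, add_zero]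
  rw [Finsupp.lsum_single, dif_pos hn]
  rfl

theorem actionOnOne_mode_of_nonneg (x : 𝔤) {n : ℤ} (hn : 0 ≤ n) :
    actionOnOne t k (mode x n) = 0 := by
  simp only [actionOnOne, LinearMap.add_apply, LinearMap.comp_apply, loopPart_mode,
    LinearMap.smul_apply, centralPart_mode, map_zero, smul_zero, add_zero]
  rw [Finsupp.lsum_single, dif_neg hn.not_gt]
  rfl

theorem actionOnOne_central : actionOnOne t k (central 𝔤 t) = algebraMap ℂ _ k := by
  simp [actionOnOne, loopPart_central, centralPart_central, Algebra.algebraMap_eq_smul_one]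

theorem actionOnOne_coe (q : negativePart 𝔤 t) :
    actionOnOne t k q = UniversalEnvelopingAlgebra.ι ℂ q := by
  obtain ⟨q, hq⟩ := q
  have hq' : q ∈ Submodule.span ℂ {y | ∃ (x : 𝔤) (n : ℤ), n < 0 ∧ y = mode x n} := hq
  induction hq' using Submodule.span_induction with
  | mem y hy => obtain ⟨x, n, hn, rfl⟩ := hy; exact actionOnOne_mode_of_neg x hn
  | zero => exact (map_zero (actionOnOne t k)).trans (map_zero (UniversalEnvelopingAlgebra.ι ℂ)).symm
  | add y z hy hz hy' hz' =>
    exact (map_add (actionOnOne t k) y z).trans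
      ((congrArg₂ (· + ·) (hy' hy) (hz' hz)).trans
        (map_add (UniversalEnvelopingAlgebra.ι ℂ)
          (⟨y, hy⟩ : negativePart 𝔤 t) ⟨z, hz⟩).symm)
  | smul c y hy hy' =>
    exact (map_smul (actionOnOne t k) c y).trans
      ((congrArg (c • ·) (hy' hy)).trans
        (map_smul (UniversalEnvelopingAlgebra.ι ℂ) c (⟨y, hy⟩ : negativePart 𝔤 t)).symm)

theorem actionOnOne_of_mem_nonnegativePart {p : AffineLieAlgebra 𝔤 t}
    (hp : p ∈ nonnegativePart 𝔤 t) :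
    actionOnOne t k p = algebraMap ℂ _ ((k • centralPart t) p) := by
  induction hp using Submodule.span_induction with
  | mem y hy =>
    rcases hy with ⟨x, n, hn, rfl⟩ | rfl
    · simp [actionOnOne_mode_of_nonneg x hn, centralPart_mode]
    · simp [actionOnOne_central, centralPart_central]
  | zero => simp
  | add y z _ _ hy hz => simp only [map_add, hy, hz]
  | smul c y _ hy => rw [map_smul, hy, map_smul, smul_eq_mul, map_mul, Algebra.smul_def]

theorem actionOnOne_lie {p p' : AffineLieAlgebra 𝔤 t} (hp : p ∈ nonnegativePart 𝔤 t)
    (hp' : p' ∈ nonnegativePart 𝔤 t) : actionOnOne t k ⁅p, p'⁆ = 0 := by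
  induction hp, hp' using Submodule.span_induction₂ with
  | mem_mem y z hy hz =>
    rcases hy with ⟨x, m, hm, rfl⟩ | rfl
    · rcases hz with ⟨x', n, hn, rfl⟩ | rfl
      · rw [lie_mode_mode, map_add, actionOnOne_mode_of_nonneg _ (by omega), map_smul, zero_add]
        -- For `m, n ≥ 0` a central term requires `m = n = 0`, and then the factor `m` of the
        -- cocycle vanishes.
        split_ifs with h
        · obtain rfl : m = 0 := by omega
          simp
        · exact zero_smul _ _
      · rw [lie_central, map_zero]
    · rw [← lie_skew, lie_central, neg_zero, map_zero]
  | zero_left y _ => rw [zero_lie, map_zero]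
  | zero_right y _ => rw [lie_zero, map_zero]
  | add_left x y z _ _ _ hx hy => rw [add_lie, map_add, hx, hy, add_zero]
  | add_right x y z _ _ _ hx hy => rw [lie_add, map_add, hx, hy, add_zero]
  | smul_left r x y _ _ h => rw [smul_lie, map_smul, h, smul_zero]
  | smul_right r x y _ _ h => rw [lie_smul, map_smul, h, smul_zero]

variable (t k) in
/-- The action of the affine Lie algebra on the enveloping algebra of `𝔤 ⊗ t⁻¹ ℂ[t⁻¹]` in which
`K` acts by `k` and `𝔤[t]` annihilates `1`. -/
def realization : AffineLieAlgebra 𝔤 t →ₗ⁅ℂ⁆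
    Module.End ℂ (UniversalEnvelopingAlgebra ℂ (negativePart 𝔤 t)) :=
  { extendedAction (actionOnOne t k) with
    map_lie' := by
      intro y z
      refine LinearMap.ext fun m => ?_
      exact extendedAction_lie actionOnOne_coe nonnegativePart_sup_negativePart
        (fun p hp => actionOnOne_of_mem_nonnegativePart hp)
        (fun p hp p' hp' => actionOnOne_lie hp hp') y z m }

theorem realization_one (y : AffineLieAlgebra 𝔤 t) : realization t k y 1 = actionOnOne t k y :=
  extendedAction_one y

theorem realization_mode_of_neg (x : 𝔤) {n : ℤ} (hn : n < 0)
    (m : UniversalEnvelopingAlgebra ℂ (negativePart 𝔤 t)) :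
    realization t k (mode x n) m =
      UniversalEnvelopingAlgebra.ι ℂ ⟨mode x n, mode_mem_negativePart x hn⟩ * m :=
  extendedAction_of_mem actionOnOne_coe ⟨mode x n, mode_mem_negativePart x hn⟩ m

variable (t k) in
/-- The action of the enveloping algebra on `1` in `realization t k`. -/
def evalOne : EnvelopingAlgebra 𝔤 t →ₗ[ℂ] UniversalEnvelopingAlgebra ℂ (negativePart 𝔤 t) :=
  LinearMap.applyₗ 1 ∘ₗ (UniversalEnvelopingAlgebra.lift ℂ (realization t k)).toLinearMap

theorem evalOne_mul (X Y : EnvelopingAlgebra 𝔤 t) : evalOne t k (X * Y) =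
    UniversalEnvelopingAlgebra.lift ℂ (realization t k) X (evalOne t k Y) := by
  simp [evalOne]

theorem evalOne_ι (y : AffineLieAlgebra 𝔤 t) :
    evalOne t k (UniversalEnvelopingAlgebra.ι ℂ y) = actionOnOne t k y := by
  rw [← realization_one]
  simp [evalOne]

/-- In the realization, `1` satisfies the relations imposed on `𝟏`, so `X ↦ X · 1` factors through
`N(k, 0)`. -/
theorem evalOne_eq_zero {X : EnvelopingAlgebra 𝔤 t} (hX : X • vacuum 𝔤 t k = 0) :
    evalOne t k X = 0 := by
  have hX' : X ⊗ₜ[ℂ] (TrivialLieModule.equiv ℂ 𝔤 ℂ).symm 1 ∈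
      inducedRelations 𝔤 t k (TrivialLieModule ℂ 𝔤 ℂ) := by
    rw [← Submodule.Quotient.mk_eq_zero]
    refine Eq.trans ?_ hX
    rw [vacuum, Submodule.mkQ_apply, ← Submodule.Quotient.mk_smul, TensorProduct.smul_tmul',
      smul_eq_mul, mul_one]
  let Ψ : EnvelopingAlgebra 𝔤 t ⊗[ℂ] TrivialLieModule ℂ 𝔤 ℂ →ₗ[ℂ]
      UniversalEnvelopingAlgebra ℂ (negativePart 𝔤 t) :=
    TensorProduct.lift ((LinearMap.lsmul ℂ _ ∘ₗ
      (TrivialLieModule.equiv ℂ 𝔤 ℂ).toLinearMap).flip ∘ₗ evalOne t k)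
  have hΨ (Y : EnvelopingAlgebra 𝔤 t) (u : TrivialLieModule ℂ 𝔤 ℂ) :
      Ψ (Y ⊗ₜ u) = TrivialLieModule.equiv ℂ 𝔤 ℂ u • evalOne t k Y := rfl
  have hsmul (Y : EnvelopingAlgebra 𝔤 t) (z) :
      Ψ (Y • z) = UniversalEnvelopingAlgebra.lift ℂ (realization t k) Y (Ψ z) := by
    induction z with
    | zero => simp
    | tmul Z u => rw [TensorProduct.smul_tmul', hΨ, hΨ, smul_eq_mul, evalOne_mul, map_smul]
    | add z z' h h' => rw [smul_add, map_add, h, h', map_add, map_add]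
  have key (z) (hz : z ∈ inducedRelations 𝔤 t k (TrivialLieModule ℂ 𝔤 ℂ)) : Ψ z = 0 := by
    induction hz using Submodule.span_induction with
    | mem z hz =>
      rcases hz with (⟨x, u, rfl⟩ | ⟨x, n, u, hn, rfl⟩) | ⟨u, rfl⟩
      · rw [trivial_lie_zero, TensorProduct.tmul_zero, sub_zero, hΨ, envMode, evalOne_ι,
          actionOnOne_mode_of_nonneg x le_rfl, smul_zero]
      · rw [hΨ, envMode, evalOne_ι, actionOnOne_mode_of_nonneg x hn.le, smul_zero]
      · rw [map_sub, hΨ, hΨ, evalOne_ι, actionOnOne_central, map_smul]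
        simp [evalOne, Algebra.algebraMap_eq_smul_one, smul_smul, mul_comm]
    | zero => exact map_zero Ψ
    | add z z' _ _ h h' => rw [map_add, h, h', add_zero]
    | smul Y z _ h => rw [hsmul, h, map_zero]
  have h := key _ hX'
  rwa [hΨ, LinearEquiv.apply_symm_apply, one_smul] at h

/-- The character of `𝔤 ⊗ t⁻¹ ℂ[t⁻¹]` given by a linear functional on `𝔤 ⊗ t⁻¹`. -/
def negativeCharacter (t : 𝔤) (lam : 𝔤 →ₗ[ℂ] ℂ) : negativePart 𝔤 t →ₗ⁅ℂ⁆ ℂ :=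
  { lam ∘ₗ Finsupp.lapply (-1) ∘ₗ loopPart t ∘ₗ (negativePart 𝔤 t).toSubmodule.subtype with
    map_lie' := by
      rintro ⟨y, hy⟩ ⟨z, hz⟩
      change lam (loopPart t ⁅y, z⁆ (-1)) = ⁅_, _⁆
      rw [LieRing.of_associative_ring_bracket, mul_comm, sub_self]
      change y ∈ Submodule.span ℂ _ at hy
      change z ∈ Submodule.span ℂ _ at hz
      induction hy, hz using Submodule.span_induction₂ with
      | mem_mem y z hy hz =>
        obtain ⟨x, m, hm, rfl⟩ := hy
        obtain ⟨x', n, hn, rfl⟩ := hz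
        -- Here `m + n ≤ -2`, so a bracket has no component in `𝔤 ⊗ t⁻¹`; hence any functional on
        -- that component is a character.
        rw [lie_mode_mode, if_neg (by omega), zero_smul, add_zero, loopPart_mode,
          Finsupp.single_eq_of_ne (by omega), map_zero]
      | zero_left y _ => simp
      | zero_right y _ => simp
      | add_left x y z _ _ _ hx hy => simp [hx, hy]
      | add_right x y z _ _ _ hx hy => simp [hx, hy]
      | smul_left r x y _ _ h => simp [h]
      | smul_right r x y _ _ h => simp [h] }

variable (t k) in
/-- For every linear functional `lam` on `𝔤` there is a linear functional on `𝒰(ĝ)` which vanishes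
on the annihilator of `𝟏`, and for which left multiplication by `x(-1)` amounts to multiplication
by `lam x`, and left multiplication by `x(n)` for `n < -1` to multiplication by `0`. -/
theorem exists_functional (lam : 𝔤 →ₗ[ℂ] ℂ) : ∃ φ : EnvelopingAlgebra 𝔤 t →ₗ[ℂ] ℂ,
    φ 1 = 1 ∧ (∀ x Y, φ (envMode x (-1) * Y) = lam x * φ Y) ∧
    (∀ x Y, φ (envMode x (-2) * Y) = 0) ∧
    ∀ X, X • vacuum 𝔤 t k = 0 → φ X = 0 := by
  let Λ := UniversalEnvelopingAlgebra.lift ℂ (negativeCharacter t lam)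
  have h {n : ℤ} (hn : n < 0) (x : 𝔤) (Y : EnvelopingAlgebra 𝔤 t) :
      Λ (evalOne t k (envMode x n * Y)) =
        lam (Finsupp.single n x (-1)) * Λ (evalOne t k Y) := by
    rw [evalOne_mul, envMode, UniversalEnvelopingAlgebra.lift_ι_apply,
      realization_mode_of_neg x hn, map_mul, UniversalEnvelopingAlgebra.lift_ι_apply,
      ← loopPart_mode]
    rfl
  refine ⟨Λ.toLinearMap ∘ₗ evalOne t k, ?_, fun x Y => ?_, fun x Y => ?_, fun X hX => ?_⟩
  · simp [evalOne]
  · simpa using h (n := -1) (by norm_num) x Y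
  · simpa using h (n := -2) (by norm_num) x Y
  · simp [evalOne_eq_zero hX]

end Functional

/-! ### Computations in a module generated by a vacuum vector -/

/-- The operators `T n x` satisfy the relations of `x(n)` in a module of level `k`, and `vac` is
annihilated by `x(n)` for `n ≥ 0`. -/
structure IsVacuumAction {𝔤 M : Type*} [LieRing 𝔤] [LieAlgebra ℂ 𝔤] [AddCommGroup M] [Module ℂ M]
    (B : LinearMap.BilinForm ℂ 𝔤) (k : ℂ) (T : ℤ → 𝔤 →ₗ[ℂ] Module.End ℂ M) (vac : M) : Prop where
  comm (m n : ℤ) (x y : 𝔤) (v : M) : T m x (T n y v) = T n y (T m x v) + T (m + n) ⁅x, y⁆ v +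
    (if m + n = 0 then (m : ℂ) * B x y * k else 0) • v
  vac (n : ℤ) (hn : 0 ≤ n) (x : 𝔤) : T n x vac = 0

namespace IsVacuumAction

variable {𝔤 M : Type*} [LieRing 𝔤] [LieAlgebra ℂ 𝔤] [AddCommGroup M] [Module ℂ M]
  {B : LinearMap.BilinForm ℂ 𝔤} {k : ℂ} {T : ℤ → 𝔤 →ₗ[ℂ] Module.End ℂ M} {vac : M}
  (h : IsVacuumAction B k T vac)

include h

theorem zero_negOne (x y : 𝔤) (v : M) :
    T 0 x (T (-1) y v) = T (-1) y (T 0 x v) + T (-1) ⁅x, y⁆ v := by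
  simpa using h.comm 0 (-1) x y v

theorem zero_negTwo (x y : 𝔤) (v : M) :
    T 0 x (T (-2) y v) = T (-2) y (T 0 x v) + T (-2) ⁅x, y⁆ v := by
  simpa using h.comm 0 (-2) x y v

theorem one_negOne (x y : 𝔤) (v : M) :
    T 1 x (T (-1) y v) = T (-1) y (T 1 x v) + T 0 ⁅x, y⁆ v + (B x y * k) • v := by
  simpa using h.comm 1 (-1) x y v

theorem one_negTwo (x y : 𝔤) (v : M) :
    T 1 x (T (-2) y v) = T (-2) y (T 1 x v) + T (-1) ⁅x, y⁆ v := by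
  simpa using h.comm 1 (-2) x y v

theorem negOne_negTwo (x y : 𝔤) (v : M) :
    T (-1) x (T (-2) y v) = T (-2) y (T (-1) x v) + T (-3) ⁅x, y⁆ v := by
  simpa using h.comm (-1) (-2) x y v

theorem negOne_negOne (x y : 𝔤) (v : M) :
    T (-1) x (T (-1) y v) = T (-1) y (T (-1) x v) + T (-2) ⁅x, y⁆ v := by
  simpa using h.comm (-1) (-1) x y v

end IsVacuumAction

/-! ### The operators `u`, `v`, `w` and their commutators with `H10(0)`, `H01(0)`, `E10(0)`,
`E01(0)`, `F32(1)`. -/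

section RootVectorActions

variable {𝔤 M : Type*} [LieRing 𝔤] [LieAlgebra ℂ 𝔤] [AddCommGroup M] [Module ℂ M]
  {𝔥 : LieSubalgebra ℂ 𝔤} (b : LieAlgebra.Basis (Fin 2) 𝔥) (T : ℤ → 𝔤 →ₗ[ℂ] Module.End ℂ M)

/-- The action of `b`. -/
def actB : Module.End ℂ M :=
  T (-1) (E31 b) * T (-1) (E11 b) - T (-1) (E32 b) * T (-1) (E10 b)

/-- The action of `c`. -/
def actC : Module.End ℂ M :=
  T (-1) (E31 b) ^ 2 * T (-1) (E01 b) - T (-1) (E32 b) * T (-1) (E31 b) * T (-1) (H01 b) -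
    T (-1) (E32 b) ^ 2 * T (-1) (F01 b)

/-- The action of `w`. -/
def actW : Module.End ℂ M :=
  T (-1) (E31 b) * T (-2) (E32 b) - T (-1) (E32 b) * T (-2) (E31 b)

/-- The action of `u`. -/
def actU : Module.End ℂ M :=
  (1 / 3 : ℂ) • T (-1) (E21 b) ^ 2 - actB b T

/-- The action of `v`. -/
def actV : Module.End ℂ M :=
  (2 / 9 : ℂ) • T (-1) (E21 b) ^ 3 - T (-1) (E21 b) * actB b T - (3 : ℂ) • actC b T

variable {b T}
variable [IsTypeG2 b] {B : LinearMap.BilinForm ℂ 𝔤} {k : ℂ} {vac : M}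

namespace IsVacuumAction

theorem H10_actU (h : IsVacuumAction B k T vac) (x : M) :
    T 0 (H10 b) (actU b T x) = actU b T (T 0 (H10 b) x) + (2 : ℂ) • actU b T x := by
  simp only [actU, actB, pow_succ, pow_zero, one_mul,
    Module.End.mul_apply, LinearMap.sub_apply, LinearMap.smul_apply, LinearMap.add_apply,
    LinearMap.neg_apply, LinearMap.zero_apply, map_sub, map_smul, map_add, map_neg, map_zero,
    h.zero_negOne, h.zero_negTwo, lie_H10 b]
  module

theorem H01_actU (h : IsVacuumAction B k T vac) (x : M) :
    T 0 (H01 b) (actU b T x) = actU b T (T 0 (H01 b) x) := by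
  simp only [actU, actB, pow_succ, pow_zero, one_mul,
    Module.End.mul_apply, LinearMap.sub_apply, LinearMap.smul_apply, LinearMap.add_apply,
    LinearMap.neg_apply, LinearMap.zero_apply, map_sub, map_smul, map_add, map_neg, map_zero,
    h.zero_negOne, h.zero_negTwo, lie_H01 b]
  module

theorem H10_actV (h : IsVacuumAction B k T vac) (x : M) :
    T 0 (H10 b) (actV b T x) = actV b T (T 0 (H10 b) x) + (3 : ℂ) • actV b T x := by
  simp only [actV, actB, actC, pow_succ, pow_zero, one_mul,
    Module.End.mul_apply, LinearMap.sub_apply, LinearMap.smul_apply, LinearMap.add_apply,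
    LinearMap.neg_apply, LinearMap.zero_apply, map_sub, map_smul, map_add, map_neg, map_zero,
    h.zero_negOne, h.zero_negTwo, lie_H10 b]
  module

theorem H01_actV (h : IsVacuumAction B k T vac) (x : M) :
    T 0 (H01 b) (actV b T x) = actV b T (T 0 (H01 b) x) := by
  simp only [actV, actB, actC, pow_succ, pow_zero, one_mul,
    Module.End.mul_apply, LinearMap.sub_apply, LinearMap.smul_apply, LinearMap.add_apply,
    LinearMap.neg_apply, LinearMap.zero_apply, map_sub, map_smul, map_add, map_neg, map_zero,
    h.zero_negOne, h.zero_negTwo, lie_H01 b]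
  module

theorem H10_actW (h : IsVacuumAction B k T vac) (x : M) :
    T 0 (H10 b) (actW b T x) = actW b T (T 0 (H10 b) x) + (3 : ℂ) • actW b T x := by
  simp only [actW, pow_succ, pow_zero, one_mul,
    Module.End.mul_apply, LinearMap.sub_apply, LinearMap.smul_apply, LinearMap.add_apply,
    LinearMap.neg_apply, LinearMap.zero_apply, map_sub, map_smul, map_add, map_neg, map_zero,
    h.zero_negOne, h.zero_negTwo, lie_H10 b]
  module

theorem H01_actW (h : IsVacuumAction B k T vac) (x : M) :
    T 0 (H01 b) (actW b T x) = actW b T (T 0 (H01 b) x) := by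
  simp only [actW, pow_succ, pow_zero, one_mul,
    Module.End.mul_apply, LinearMap.sub_apply, LinearMap.smul_apply, LinearMap.add_apply,
    LinearMap.neg_apply, LinearMap.zero_apply, map_sub, map_smul, map_add, map_neg, map_zero,
    h.zero_negOne, h.zero_negTwo, lie_H01 b]
  module

variable [FiniteDimensional ℂ 𝔤]

/-- Bracketing with `E10(0)` turns both `a² / 3` and `b` into `-2 E31(-1) a`, since `E31(-1)`
commutes with `a`. The instances of `negOne_negOne` supplied to `simp` here and below are oriented:
they move vectors of higher roots to the right, which gives a normal form and avoids looping. -/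
theorem E10_actU (h : IsVacuumAction B k T vac) (x : M) :
    T 0 (E10 b) (actU b T x) = actU b T (T 0 (E10 b) x) := by
  simp only [actU, actB, pow_succ, pow_zero, one_mul,
    Module.End.mul_apply, LinearMap.sub_apply, LinearMap.smul_apply, LinearMap.add_apply,
    LinearMap.neg_apply, LinearMap.zero_apply, map_sub, map_smul, map_add, map_neg, map_zero,
    h.zero_negOne, h.zero_negTwo, lie_E10 b, lie_E31 b, h.negOne_negOne (E31 b) (E21 b),
    h.negOne_negOne (E31 b) (E11 b)]
  module

theorem E01_actU (h : IsVacuumAction B k T vac) (x : M) :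
    T 0 (E01 b) (actU b T x) = actU b T (T 0 (E01 b) x) := by
  simp only [actU, actB, pow_succ, pow_zero, one_mul,
    Module.End.mul_apply, LinearMap.sub_apply, LinearMap.smul_apply, LinearMap.add_apply,
    LinearMap.neg_apply, LinearMap.zero_apply, map_sub, map_smul, map_add, map_neg, map_zero,
    h.zero_negOne, h.zero_negTwo, lie_E01 b, lie_E32 b, h.negOne_negOne (E32 b) (E11 b)]
  module

/-- Up to the common left factor `E31(-1)`, the three terms of `v` contribute `-2a²`, `3b + 2a²` and
`-3b`. -/
theorem E10_actV (h : IsVacuumAction B k T vac) (x : M) :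
    T 0 (E10 b) (actV b T x) = actV b T (T 0 (E10 b) x) := by
  simp only [actV, actB, actC, pow_succ, pow_zero, one_mul,
    Module.End.mul_apply, LinearMap.sub_apply, LinearMap.smul_apply, LinearMap.add_apply,
    LinearMap.neg_apply, LinearMap.zero_apply, map_sub, map_smul, map_add, map_neg, map_zero,
    h.zero_negOne, h.zero_negTwo, lie_E10 b, lie_E31 b, lie_E32 b, h.negOne_negOne (E31 b) (E21 b),
    h.negOne_negOne (E31 b) (E11 b), h.negOne_negOne (E31 b) (E10 b),
    h.negOne_negOne (E32 b) (E31 b)]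
  module

theorem E01_actV (h : IsVacuumAction B k T vac) (x : M) :
    T 0 (E01 b) (actV b T x) = actV b T (T 0 (E01 b) x) := by
  simp only [actV, actB, actC, pow_succ, pow_zero, one_mul,
    Module.End.mul_apply, LinearMap.sub_apply, LinearMap.smul_apply, LinearMap.add_apply,
    LinearMap.neg_apply, LinearMap.zero_apply, map_sub, map_smul, map_add, map_neg, map_zero,
    h.zero_negOne, h.zero_negTwo, lie_E01 b, lie_E32 b, h.negOne_negOne (E32 b) (E31 b),
    h.negOne_negOne (E32 b) (H01 b), h.negOne_negOne (E32 b) (E01 b),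
    h.negOne_negOne (E32 b) (E21 b)]
  module

theorem E10_actW (h : IsVacuumAction B k T vac) (x : M) :
    T 0 (E10 b) (actW b T x) = actW b T (T 0 (E10 b) x) := by
  simp only [actW, pow_succ, pow_zero, one_mul,
    Module.End.mul_apply, LinearMap.sub_apply, LinearMap.smul_apply, LinearMap.add_apply,
    LinearMap.neg_apply, LinearMap.zero_apply, map_sub, map_smul, map_add, map_neg, map_zero,
    h.zero_negOne, h.zero_negTwo, lie_E10 b]
  module

theorem E01_actW (h : IsVacuumAction B k T vac) (x : M) :
    T 0 (E01 b) (actW b T x) = actW b T (T 0 (E01 b) x) := by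
  simp only [actW, pow_succ, pow_zero, one_mul,
    Module.End.mul_apply, LinearMap.sub_apply, LinearMap.smul_apply, LinearMap.add_apply,
    LinearMap.neg_apply, LinearMap.zero_apply, map_sub, map_smul, map_add, map_neg, map_zero,
    h.zero_negOne, h.zero_negTwo, lie_E01 b]
  module

variable [LieAlgebra.IsSimple ℂ 𝔤]

/-- At level `k` the result is `(k + 5/3) E10(-1) 𝟏`: `a² / 3` contributes `2/3`, and `-b`
contributes `1 + k`. -/
theorem F32_actU (h : IsVacuumAction (normalizedKillingForm 𝔤 (H32 b)) (-5 / 3) T vac) :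
    T 1 (F32 b) (actU b T vac) = 0 := by
  simp only [actU, actV, actW, actB, actC, pow_succ, pow_zero, one_mul,
    Module.End.mul_apply, LinearMap.sub_apply, LinearMap.smul_apply, LinearMap.add_apply,
    LinearMap.neg_apply, LinearMap.zero_apply, map_sub, map_smul, map_add, map_neg, map_zero,
    h.one_negOne, h.one_negTwo, h.zero_negOne, h.zero_negTwo, h.negOne_negTwo,
    lie_F01 b, lie_F11 b, lie_F21 b, lie_F31 b, lie_F32 b, lie_H01 b, lie_H10 b,
    normalizedKillingForm_F32 b, h.vac 0 le_rfl, h.vac 1 zero_le_one, smul_zero, add_zero, zero_add,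
    zero_mul, zero_smul]
  module

/-- The term `w` is needed: `F32(1) v 𝟏` contains `E31(-1) H10(-1) 𝟏` with coefficient `1` at every
level, and `w` cancels it. What remains is `k + 4/3` times a fixed vector. -/
theorem F32_actV_add_actW (h : IsVacuumAction (normalizedKillingForm 𝔤 (H32 b)) (-4 / 3) T vac) :
    T 1 (F32 b) (actV b T vac + actW b T vac) = 0 := by
  simp only [actU, actV, actW, actB, actC, pow_succ, pow_zero, one_mul,
    Module.End.mul_apply, LinearMap.sub_apply, LinearMap.smul_apply, LinearMap.add_apply,
    LinearMap.neg_apply, LinearMap.zero_apply, map_sub, map_smul, map_add, map_neg, map_zero,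
    h.one_negOne, h.one_negTwo, h.zero_negOne, h.zero_negTwo, h.negOne_negTwo,
    h.negOne_negOne (E21 b) (E10 b), h.negOne_negOne (E21 b) (E11 b),
    h.negOne_negOne (E31 b) (E01 b),
    h.negOne_negOne (E31 b) (E11 b), h.negOne_negOne (E31 b) (E21 b),
    h.negOne_negOne (E31 b) (H01 b),
    h.negOne_negOne (E31 b) (H10 b), h.negOne_negOne (E32 b) (E10 b),
    h.negOne_negOne (E32 b) (E31 b),
    h.negOne_negOne (E32 b) (F01 b), h.negOne_negOne (E32 b) (H01 b),
    lie_E21 b, lie_E31 b, lie_E32 b, lie_F01 b, lie_F11 b, lie_F21 b, lie_F31 b, lie_F32 b,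
    lie_H01 b,
    lie_H10 b,
    normalizedKillingForm_F32 b, h.vac 0 le_rfl, h.vac 1 zero_le_one, smul_zero, add_zero, zero_add,
    zero_mul, zero_smul]
  module

set_option maxHeartbeats 1000000 in
theorem F32_actU_actV (h : IsVacuumAction (normalizedKillingForm 𝔤 (H32 b)) (-2 / 3) T vac) :
    T 1 (F32 b) (actU b T (actV b T vac - actW b T vac)) = 0 := by
  simp only [actU, actV, actW, actB, actC, pow_succ, pow_zero, one_mul,
    Module.End.mul_apply, LinearMap.sub_apply, LinearMap.smul_apply, LinearMap.add_apply,
    LinearMap.neg_apply, LinearMap.zero_apply, map_sub, map_smul, map_add, map_neg, map_zero,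
    h.one_negOne, h.one_negTwo, h.zero_negOne, h.zero_negTwo, h.negOne_negTwo,
    h.negOne_negOne (E10 b) (E01 b), h.negOne_negOne (E10 b) (F01 b),
    h.negOne_negOne (E10 b) (H01 b),
    h.negOne_negOne (E10 b) (H10 b), h.negOne_negOne (E11 b) (E01 b),
    h.negOne_negOne (E11 b) (E10 b),
    h.negOne_negOne (E11 b) (F01 b), h.negOne_negOne (E11 b) (H01 b),
    h.negOne_negOne (E11 b) (H10 b),
    h.negOne_negOne (E21 b) (E01 b), h.negOne_negOne (E21 b) (E10 b),
    h.negOne_negOne (E21 b) (E11 b),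
    h.negOne_negOne (E21 b) (F01 b), h.negOne_negOne (E21 b) (F10 b),
    h.negOne_negOne (E21 b) (F11 b),
    h.negOne_negOne (E21 b) (H01 b), h.negOne_negOne (E21 b) (H10 b),
    h.negOne_negOne (E31 b) (E01 b),
    h.negOne_negOne (E31 b) (E10 b), h.negOne_negOne (E31 b) (E11 b),
    h.negOne_negOne (E31 b) (E21 b),
    h.negOne_negOne (E31 b) (F01 b), h.negOne_negOne (E31 b) (H01 b),
    h.negOne_negOne (E31 b) (H10 b),
    h.negOne_negOne (E32 b) (E01 b), h.negOne_negOne (E32 b) (E10 b),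
    h.negOne_negOne (E32 b) (E11 b),
    h.negOne_negOne (E32 b) (E21 b), h.negOne_negOne (E32 b) (E31 b),
    h.negOne_negOne (E32 b) (F01 b),
    h.negOne_negOne (E32 b) (H01 b), h.negOne_negOne (E32 b) (H10 b),
    lie_F32 b, lie_F31 b, lie_F21 b, lie_F11 b, lie_F01 b, lie_H10 b, lie_H01 b, lie_E10 b,
    lie_E11 b, lie_E21 b, lie_E31 b, lie_E32 b,
    normalizedKillingForm_F32 b, h.vac 0 le_rfl, h.vac 1 zero_le_one, smul_zero, add_zero, zero_add,
    zero_mul, zero_smul]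
  module

end IsVacuumAction

end RootVectorActions

/-! ### The action of the affine Lie algebra on `N(k, 0)` -/

section VacuumModule

attribute [local instance 100] LieRing.ofAssociativeRing

variable {𝔤 : Type*} [LieRing 𝔤] [LieAlgebra ℂ 𝔤] {t : 𝔤} {k : ℂ}

variable (t k) in
/-- The operators `x(n)` on `N(k, 0)`. -/
def modeAction (n : ℤ) : 𝔤 →ₗ[ℂ] Module.End ℂ (VacuumModule 𝔤 t k) :=
  (Algebra.lsmul ℂ ℂ (VacuumModule 𝔤 t k)).toLinearMap ∘ₗ
    (UniversalEnvelopingAlgebra.ι ℂ).toLinearMap ∘ₗ modeLinear t n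

theorem modeAction_apply (n : ℤ) (x : 𝔤) (v : VacuumModule 𝔤 t k) :
    modeAction t k n x v = (envMode x n : EnvelopingAlgebra 𝔤 t) • v := rfl

/-- The defining relations prescribe the action of `K` only on `1 ⊗ u`; centrality of `K` carries it
to `X ⊗ u`. -/
theorem central_smul (v : VacuumModule 𝔤 t k) :
    UniversalEnvelopingAlgebra.ι ℂ (central 𝔤 t) • v = k • v := by
  have hcomm (X : EnvelopingAlgebra 𝔤 t) : UniversalEnvelopingAlgebra.ι ℂ (central 𝔤 t) * X =
      X * UniversalEnvelopingAlgebra.ι ℂ (central 𝔤 t) := by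
    induction X using envelopingAlgebra_induction with
    | one => rw [mul_one, one_mul]
    | add X Y hX hY => rw [mul_add, hX, hY, add_mul]
    | smul c X hX => rw [mul_smul_comm, hX, smul_mul_assoc]
    | ι_mul x X hX =>
      have h := LieHom.map_lie (UniversalEnvelopingAlgebra.ι ℂ) x (central 𝔤 t)
      rw [lie_central, map_zero, LieRing.of_associative_ring_bracket, eq_comm,
        sub_eq_zero] at h
      rw [← mul_assoc, ← h, mul_assoc, hX, mul_assoc]
  obtain ⟨z, rfl⟩ := Submodule.Quotient.mk_surjective _ v
  rw [← Submodule.Quotient.mk_smul, ← Submodule.Quotient.mk_smul]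
  induction z with
  | zero => rw [smul_zero, smul_zero]
  | add z z' h h' => rw [smul_add, smul_add, Submodule.Quotient.mk_add, h, h',
      Submodule.Quotient.mk_add]
  | tmul X u =>
    refine (Submodule.Quotient.eq _).mpr ?_
    have h : UniversalEnvelopingAlgebra.ι ℂ (central 𝔤 t) • X ⊗ₜ[ℂ] u - k • X ⊗ₜ[ℂ] u =
        X • (UniversalEnvelopingAlgebra.ι ℂ (central 𝔤 t) ⊗ₜ[ℂ] u - 1 ⊗ₜ[ℂ] (k • u)) := by
      rw [smul_sub, TensorProduct.smul_tmul', TensorProduct.smul_tmul', TensorProduct.smul_tmul',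
        TensorProduct.smul_tmul', smul_eq_mul, smul_eq_mul, smul_eq_mul, hcomm, mul_one,
        TensorProduct.smul_tmul]
    rw [h]
    exact Submodule.smul_mem _ _ (Submodule.subset_span (Or.inr ⟨u, rfl⟩))

theorem envMode_smul_vacuum (x : 𝔤) {n : ℤ} (hn : 0 ≤ n) :
    (envMode x n : EnvelopingAlgebra 𝔤 t) • vacuum 𝔤 t k = 0 := by
  rw [vacuum, Submodule.mkQ_apply, ← Submodule.Quotient.mk_smul, TensorProduct.smul_tmul',
    smul_eq_mul, mul_one]
  refine (Submodule.Quotient.mk_eq_zero _).mpr (Submodule.subset_span (Or.inl ?_))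
  rcases hn.eq_or_lt with rfl | hn
  · exact Or.inl ⟨x, (TrivialLieModule.equiv ℂ 𝔤 ℂ).symm 1, by
      rw [trivial_lie_zero, TensorProduct.tmul_zero, sub_zero]⟩
  · exact Or.inr ⟨x, n, _, hn, rfl⟩

theorem isVacuumAction_modeAction : IsVacuumAction (normalizedKillingForm 𝔤 t) k
    (modeAction t k) (vacuum 𝔤 t k) where
  comm m n x y v := by
    have h := LieHom.map_lie (UniversalEnvelopingAlgebra.ι ℂ)
      (mode x m : AffineLieAlgebra 𝔤 t) (mode y n)
    rw [lie_mode_mode, LieRing.of_associative_ring_bracket, map_add, map_smul] at h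
    change envMode ⁅x, y⁆ (m + n) + _ = envMode x m * envMode y n - envMode y n * envMode x m at h
    simp only [modeAction_apply]
    rw [smul_smul, ← add_eq_of_eq_sub h, add_smul, add_smul, smul_assoc, central_smul, smul_smul,
      smul_smul, ite_mul, zero_mul]
    abel
  vac n hn x := envMode_smul_vacuum x hn

end VacuumModule

/-! ### A criterion for singular vectors -/

section Criterion

attribute [local instance 100] LieRing.ofAssociativeRing

variable {𝔤 : Type*} [LieRing 𝔤] [LieAlgebra ℂ 𝔤] {𝔥 : LieSubalgebra ℂ 𝔤} {t : 𝔤} {k : ℂ}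

/-- The eigenvalue is linear in `y` because `y v` stays on the line `ℂ v`, which `v ≠ 0` identifies
with `ℂ`. -/
theorem isWeightVector_of_forall {v : VacuumModule 𝔤 t k} (hv : v ≠ 0)
    (h : ∀ x ∈ 𝔥, ∃ c : ℂ, modeAction t k 0 x v = c • v) : IsWeightVector 𝔥 v := by
  refine ⟨hv, ?_⟩
  have key : ∀ y ∈ affineCartan 𝔥 t,
      UniversalEnvelopingAlgebra.ι ℂ y • v ∈ Submodule.span ℂ {v} := by
    intro y hy
    induction hy using Submodule.span_induction with
    | mem y hy =>
      rcases hy with ⟨x, hx, rfl⟩ | rfl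
      · obtain ⟨c, hc⟩ := h x hx
        exact Submodule.mem_span_singleton.mpr ⟨c, hc.symm⟩
      · exact Submodule.mem_span_singleton.mpr ⟨k, (central_smul v).symm⟩
    | zero => rw [map_zero, zero_smul]; exact zero_mem _
    | add y z _ _ hy hz => rw [map_add, add_smul]; exact add_mem hy hz
    | smul c y _ hy => rw [map_smul, smul_assoc]; exact Submodule.smul_mem _ c hy
  let A : affineCartan 𝔥 t →ₗ[ℂ] Submodule.span ℂ {v} :=
    (((Algebra.lsmul ℂ ℂ (VacuumModule 𝔤 t k)).toLinearMap ∘ₗ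
      (UniversalEnvelopingAlgebra.ι ℂ).toLinearMap ∘ₗ (affineCartan 𝔥 t).subtype).flip v).codRestrict
        _ fun y => key y y.2
  refine ⟨(LinearEquiv.toSpanNonzeroSingleton ℂ _ v hv).symm.toLinearMap ∘ₗ A, fun y => ?_⟩
  exact (congrArg Subtype.val
    ((LinearEquiv.toSpanNonzeroSingleton ℂ _ v hv).apply_symm_apply (A y))).symm

variable {b : LieAlgebra.Basis (Fin 2) 𝔥}

theorem modeAction_zero_eq_zero {v : VacuumModule 𝔤 t k} (h10 : modeAction t k 0 (E10 b) v = 0)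
    (h01 : modeAction t k 0 (E01 b) v = 0) {x : 𝔤}
    (hx : x ∈ LieSubalgebra.lieSpan ℂ 𝔤 (Set.range b.e)) : modeAction t k 0 x v = 0 := by
  induction hx using LieSubalgebra.lieSpan_induction with
  | mem x hx =>
    obtain ⟨i, rfl⟩ := hx
    fin_cases i
    · exact h10
    · exact h01
  | zero => simp
  | add x y _ _ hx hy => simp [hx, hy]
  | smul c x _ hx => simp [hx]
  | lie x y _ _ hx hy =>
    have h := isVacuumAction_modeAction.comm 0 0 x y v
    rw [hx, hy] at h
    simpa using h.symm

theorem lie_top_top_eq_top [LieAlgebra.IsSimple ℂ 𝔤] :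
    ⁅(⊤ : LieIdeal ℂ 𝔤), (⊤ : LieIdeal ℂ 𝔤)⁆ = ⊤ := by
  refine (LieAlgebra.IsSimple.eq_bot_or_eq_top _).resolve_left fun h => ?_
  refine LieAlgebra.IsSimple.non_abelian ℂ (L := 𝔤) ⟨fun x y => ?_⟩
  have hxy := LieSubmodule.lie_mem_lie (LieSubmodule.mem_top (R := ℂ) (L := 𝔤) x)
    (LieSubmodule.mem_top (R := ℂ) (L := 𝔤) y)
  rwa [h, LieSubmodule.mem_bot] at hxy

/-- As `𝔤 = [𝔤, 𝔤]`, every `x(n + 1)` is a sum of commutators `[y(n), z(1)]`, which have no central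
term. -/
theorem modeAction_pos_eq_zero [LieAlgebra.IsSimple ℂ 𝔤] {v : VacuumModule 𝔤 t k}
    (h : ∀ x, modeAction t k 1 x v = 0) {n : ℤ} (hn : 1 ≤ n) (x : 𝔤) :
    modeAction t k n x v = 0 := by
  induction n, hn using Int.leInduction generalizing x with
  | base => exact h x
  | succ n hn ih =>
    have hx : x ∈ ⁅(⊤ : LieIdeal ℂ 𝔤), (⊤ : LieIdeal ℂ 𝔤)⁆ := by
      rw [lie_top_top_eq_top]; trivial
    rw [← LieSubmodule.mem_toSubmodule, LieSubmodule.lieIdeal_oper_eq_linear_span'] at hx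
    induction hx using Submodule.span_induction with
    | mem x hx =>
      obtain ⟨y, -, z, -, rfl⟩ := hx
      have h' := isVacuumAction_modeAction.comm n 1 y z v
      rw [h z, ih y, map_zero, map_zero, if_neg (by omega), zero_smul, add_zero, zero_add] at h'
      exact h'.symm
    | zero => simp
    | add x y _ _ hx hy => simp [hx, hy]
    | smul c x _ hx => simp [hx]

variable [IsTypeG2 b] [FiniteDimensional ℂ 𝔤]

/-- The `x` with `x(1) v = 0` form a subspace stable under `ad E10` and `ad E01`. Starting from the
lowest root vector, these reach every root vector and both simple coroots. -/
theorem modeAction_one_eq_zero {v : VacuumModule 𝔤 t k} (h10 : modeAction t k 0 (E10 b) v = 0)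
    (h01 : modeAction t k 0 (E01 b) v = 0) (hF : modeAction t k 1 (F32 b) v = 0) (x : 𝔤) :
    modeAction t k 1 x v = 0 := by
  let S : Submodule ℂ 𝔤 := LinearMap.ker ((modeAction t k 1).flip v)
  have step {e x : 𝔤} (he : modeAction t k 0 e v = 0) (hx : x ∈ S) : ⁅e, x⁆ ∈ S := by
    have hx' : modeAction t k 1 x v = 0 := hx
    have h := isVacuumAction_modeAction.comm 0 1 e x v
    rw [hx', he, map_zero, map_zero] at h
    simpa [S] using h.symm
  have h32 : F32 b ∈ S := hF
  have h31 : F31 b ∈ S := by simpa [lie_E01 b] using step h01 h32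
  have h21 : F21 b ∈ S := by simpa [lie_E10 b] using step h10 h31
  have h11 : F11 b ∈ S := by simpa [lie_E10 b, Submodule.smul_mem_iff] using step h10 h21
  have hF01 : F01 b ∈ S := by simpa [lie_E10 b, Submodule.smul_mem_iff] using step h10 h11
  have hF10 : F10 b ∈ S := by simpa [lie_E01 b] using step h01 h11
  have hH10 : H10 b ∈ S := by simpa [lie_E10 b] using step h10 hF10
  have hH01 : H01 b ∈ S := by simpa [lie_E01 b] using step h01 hF01
  have hE10 : E10 b ∈ S := by simpa [lie_E10 b] using step h10 hH01
  have hE01 : E01 b ∈ S := by simpa [lie_E01 b, Submodule.smul_mem_iff] using step h01 hH01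
  have hE11 : E11 b ∈ S := by simpa [lie_E10 b] using step h10 hE01
  have hE21 : E21 b ∈ S := by simpa [lie_E10 b, Submodule.smul_mem_iff] using step h10 hE11
  have hE31 : E31 b ∈ S := by simpa [lie_E10 b, Submodule.smul_mem_iff] using step h10 hE21
  have hE32 : E32 b ∈ S := by simpa [lie_E01 b] using step h01 hE31
  have hS : Submodule.span ℂ (rootVectors b) ≤ S := by
    rw [Submodule.span_le]
    intro y hy
    simp only [rootVectors, Set.mem_insert_iff, Set.mem_singleton_iff] at hy
    rcases hy with rfl | rfl | rfl | rfl | rfl | rfl | rfl | rfl | rfl | rfl | rfl | rfl | rfl | rfl <;>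
    assumption
  rw [span_rootVectors] at hS
  exact hS (Submodule.mem_top (x := x))

theorem isSingularVector_of_generators [LieAlgebra.IsSimple ℂ 𝔤] {v : VacuumModule 𝔤 t k}
    (hv : v ≠ 0) {p q : ℂ} (hH10 : modeAction t k 0 (H10 b) v = p • v)
    (hH01 : modeAction t k 0 (H01 b) v = q • v) (h10 : modeAction t k 0 (E10 b) v = 0)
    (h01 : modeAction t k 0 (E01 b) v = 0) (hF : modeAction t k 1 (F32 b) v = 0) :
    IsSingularVector b v := by
  refine ⟨isWeightVector_of_forall hv fun x hx => ?_, fun y hy => ?_⟩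
  · rw [← LieSubalgebra.mem_toSubmodule, b.coe_cartan_eq_span] at hx
    induction hx using Submodule.span_induction with
    | mem x hx =>
      obtain ⟨i, rfl⟩ := hx
      fin_cases i
      · exact ⟨p, hH10⟩
      · exact ⟨q, H01_eq b ▸ hH01⟩
    | zero => exact ⟨0, by simp⟩
    | add x y _ _ hx hy =>
      obtain ⟨c, hc⟩ := hx
      obtain ⟨d, hd⟩ := hy
      exact ⟨c + d, by rw [map_add, LinearMap.add_apply, hc, hd, add_smul]⟩
    | smul r x _ hx =>
      obtain ⟨c, hc⟩ := hx
      exact ⟨r * c, by rw [map_smul, LinearMap.smul_apply, hc, smul_smul]⟩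
  · induction hy using Submodule.span_induction with
    | mem y hy =>
      rcases hy with ⟨x, hx, rfl⟩ | ⟨x, n, hn, rfl⟩
      · exact modeAction_zero_eq_zero h10 h01 hx
      · exact modeAction_pos_eq_zero (modeAction_one_eq_zero h10 h01 hF) hn x
    | zero => rw [map_zero, zero_smul]
    | add y z _ _ hy hz => rw [map_add, add_smul, hy, hz, add_zero]
    | smul c y _ hy => rw [map_smul, smul_assoc, hy, smul_zero]

end Criterion

/-! ### The three singular vectors -/

section SingularVectors

variable {𝔤 : Type*} [LieRing 𝔤] [LieAlgebra ℂ 𝔤] {𝔥 : LieSubalgebra ℂ 𝔤}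
  {b : LieAlgebra.Basis (Fin 2) 𝔥} {k : ℂ}

theorem elemU_smul (x : VacuumModule 𝔤 (H32 b) k) :
    elemU b • x = actU b (modeAction (H32 b) k) x := by
  simp only [elemU, elemA, elemB, actU, actB, pow_succ, pow_zero, one_mul, sub_smul, smul_assoc,
    mul_smul, LinearMap.sub_apply, LinearMap.smul_apply, Module.End.mul_apply, modeAction_apply]

theorem elemV_smul (x : VacuumModule 𝔤 (H32 b) k) :
    elemV b • x = actV b (modeAction (H32 b) k) x := by
  simp only [elemV, elemA, elemB, elemC, actV, actB, actC, pow_succ, pow_zero, one_mul, sub_smul,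
    smul_assoc, mul_smul, LinearMap.sub_apply, LinearMap.smul_apply, Module.End.mul_apply,
    modeAction_apply, smul_sub]

theorem elemW_smul (x : VacuumModule 𝔤 (H32 b) k) :
    elemW b • x = actW b (modeAction (H32 b) k) x := by
  simp only [elemW, actW, sub_smul, mul_smul, LinearMap.sub_apply, Module.End.mul_apply,
    modeAction_apply]

variable [IsTypeG2 b] [FiniteDimensional ℂ 𝔤]

/-- A functional on `𝒰(ĝ)` which vanishes on the annihilator of `𝟏` and sends
`1, u, v ± w, u (v - w)` to nonzero numbers. -/
theorem exists_functional_elem (b : LieAlgebra.Basis (Fin 2) 𝔥) [IsTypeG2 b] (k : ℂ) :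
    ∃ (φ : EnvelopingAlgebra 𝔤 (H32 b) →ₗ[ℂ] ℂ) (r : ℂ), r ≠ 0 ∧ φ 1 = 1 ∧
    (∀ Y, φ (elemU b * Y) = r ^ 2 / 3 * φ Y) ∧ (∀ Y, φ (elemV b * Y) = 2 / 9 * r ^ 3 * φ Y) ∧
    (∀ Y, φ (elemW b * Y) = 0) ∧ ∀ X, X • vacuum 𝔤 (H32 b) k = 0 → φ X = 0 := by
  -- The functional `x ↦ μ [E10, x]` kills `E31` and `E32`, which commute with `E10`, and takes the
  -- value `r = -3 μ(E31) ≠ 0` at `E21`. No linear independence of the root vectors is needed.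
  obtain ⟨μ, hμ⟩ : ∃ μ : Module.Dual ℂ 𝔤, μ (E31 b) ≠ 0 := by
    by_contra! h
    exact E31_ne_zero b ((Module.forall_dual_apply_eq_zero_iff ℂ _).mp h)
  obtain ⟨φ, h1, hneg1, hneg2, hvac⟩ :=
    exists_functional (H32 b) k (μ ∘ₗ (LieAlgebra.ad ℂ 𝔤 (E10 b) : 𝔤 →ₗ[ℂ] 𝔤))
  have h21 : μ ⁅E10 b, E21 b⁆ = -3 * μ (E31 b) := by simp only [lie_E10 b, map_smul, smul_eq_mul]
  have h31 : μ ⁅E10 b, E31 b⁆ = 0 := by simp only [lie_E10 b, map_zero]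
  have h32 : μ ⁅E10 b, E32 b⁆ = 0 := by simp only [lie_E10 b, map_zero]
  simp only [LinearMap.comp_apply, LieAlgebra.ad_apply] at hneg1
  refine ⟨φ, -3 * μ (E31 b), mul_ne_zero (by norm_num) hμ, h1, fun Y => ?_, fun Y => ?_,
    fun Y => ?_, hvac⟩
  · simp only [elemU, elemA, elemB, pow_succ, pow_zero, one_mul, sub_mul, smul_mul_assoc,
      mul_assoc, map_sub, map_smul, hneg1, h21, h31, h32, smul_eq_mul]
    ring
  · simp only [elemV, elemA, elemB, elemC, pow_succ, pow_zero, one_mul, sub_mul, mul_sub,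
      smul_mul_assoc, mul_assoc, map_sub, map_smul, hneg1, h21, h31, h32, smul_eq_mul]
    ring
  · simp only [elemW, sub_mul, mul_assoc, map_sub, hneg1, h31, h32]
    ring

end SingularVectors

end AffineG2

end

/-! ### The singular vectors at the levels `-5/3`, `-4/3` and `-2/3`. -/

open AffineG2 in
theorem proposition2p3 {𝔤 : Type*} [LieRing 𝔤] [LieAlgebra ℂ 𝔤] [FiniteDimensional ℂ 𝔤]
    [LieAlgebra.IsSimple ℂ 𝔤] {𝔥 : LieSubalgebra ℂ 𝔤} (b : LieAlgebra.Basis (Fin 2) 𝔥)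
    (hb : b.A = !![2, -1; -3, 2]) :
    AffineG2.IsSingularVector b
      (AffineG2.elemU b • AffineG2.vacuum 𝔤 (AffineG2.H32 b) (-5 / 3)) ∧
    AffineG2.IsSingularVector b
      ((AffineG2.elemV b + AffineG2.elemW b) • AffineG2.vacuum 𝔤 (AffineG2.H32 b) (-4 / 3)) ∧
    AffineG2.IsSingularVector b
      ((AffineG2.elemU b * (AffineG2.elemV b - AffineG2.elemW b)) •
        AffineG2.vacuum 𝔤 (AffineG2.H32 b) (-2 / 3)) := by
  have : IsTypeG2 b := ⟨hb⟩
  refine ⟨?_, ?_, ?_⟩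
  · obtain ⟨φ, r, hr, h1, hU, -, -, hvac⟩ := exists_functional_elem b (-5 / 3)
    have h := isVacuumAction_modeAction (t := H32 b) (k := -5 / 3)
    have hne : elemU b • vacuum 𝔤 (H32 b) (-5 / 3) ≠ 0 := fun h0 => by
      have h' := hvac _ h0
      rw [← mul_one (elemU b), hU, h1] at h'
      exact hr (by simpa using h')
    rw [elemU_smul] at hne ⊢
    -- The weights of `u`, `v ± w`, `u (v - w)` are `2`, `3`, `5` times `2α + β`, which takes the
    -- values `1` and `0` on `H10` and `H01`.
    refine isSingularVector_of_generators hne (p := 2) (q := 0) ?_ ?_ ?_ ?_ h.F32_actU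
    · rw [h.H10_actU, h.vac 0 le_rfl, map_zero, zero_add]
    · rw [h.H01_actU, h.vac 0 le_rfl, map_zero, zero_smul]
    · rw [h.E10_actU, h.vac 0 le_rfl, map_zero]
    · rw [h.E01_actU, h.vac 0 le_rfl, map_zero]
  · obtain ⟨φ, r, hr, h1, -, hV, hW, hvac⟩ := exists_functional_elem b (-4 / 3)
    have h := isVacuumAction_modeAction (t := H32 b) (k := -4 / 3)
    have hne : (elemV b + elemW b) • vacuum 𝔤 (H32 b) (-4 / 3) ≠ 0 := fun h0 => by
      have h' := hvac _ h0
      rw [← mul_one (elemV b + elemW b), add_mul, map_add, hV, hW, h1] at h'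
      exact hr (by simpa using h')
    rw [add_smul, elemV_smul, elemW_smul] at hne ⊢
    refine isSingularVector_of_generators hne (p := 3) (q := 0) ?_ ?_ ?_ ?_ h.F32_actV_add_actW
    · rw [map_add, h.H10_actV, h.H10_actW, h.vac 0 le_rfl, map_zero, map_zero, zero_add, zero_add,
        smul_add]
    · rw [map_add, h.H01_actV, h.H01_actW, h.vac 0 le_rfl, map_zero, map_zero, zero_smul, add_zero]
    · rw [map_add, h.E10_actV, h.E10_actW, h.vac 0 le_rfl, map_zero, map_zero, add_zero]
    · rw [map_add, h.E01_actV, h.E01_actW, h.vac 0 le_rfl, map_zero, map_zero, add_zero]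
  · obtain ⟨φ, r, hr, h1, hU, hV, hW, hvac⟩ := exists_functional_elem b (-2 / 3)
    have h := isVacuumAction_modeAction (t := H32 b) (k := -2 / 3)
    have hne : (elemU b * (elemV b - elemW b)) • vacuum 𝔤 (H32 b) (-2 / 3) ≠ 0 := fun h0 => by
      have h' := hvac _ h0
      rw [hU, ← mul_one (elemV b - elemW b), sub_mul, map_sub, hV, hW, h1] at h'
      exact hr (by simpa using h')
    rw [mul_smul, sub_smul, elemU_smul, elemV_smul, elemW_smul] at hne ⊢
    refine isSingularVector_of_generators hne (p := 5) (q := 0) ?_ ?_ ?_ ?_ h.F32_actU_actV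
    · rw [h.H10_actU, map_sub, h.H10_actV, h.H10_actW, h.vac 0 le_rfl, map_zero, map_zero,
        zero_add, zero_add, ← smul_sub, map_smul, ← add_smul]
      norm_num
    · rw [h.H01_actU, map_sub, h.H01_actV, h.H01_actW, h.vac 0 le_rfl, map_zero, map_zero,
        sub_zero, map_zero, zero_smul]
    · rw [h.E10_actU, map_sub, h.E10_actV, h.E10_actW, h.vac 0 le_rfl, map_zero, map_zero,
        sub_zero, map_zero]
    · rw [h.E01_actU, map_sub, h.E01_actV, h.E01_actW, h.vac 0 le_rfl, map_zero, map_zero,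
        sub_zero, map_zero]
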